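/- Let $\{\mathbb X(p)\}_p$ be independent random variables on a probability space, indexed by the primes and each uniformly distributed on the unit circle, and extend them multiplicatively by $\mathbb X(n)=\prod_i \mathbb X(p_i)^{a_i}$ for $n=\prod_i p_i^{a_i}$. Let $\Lambda$ be the von Mangoldt function. Then the series $$\mathrm{Ld}(1,\mathbb X):=-\sum_{n=1}^\infty\frac{\Lambda(n)\mathbb X(n)}{n}$$ (summed in the natural order) converges almost surely, and almost surely $$\mathrm{Ld}(1,\mathbb X)=-\sum_p\frac{(\log p)\,\mathbb X(p)}{p-\mathbb X(p)},$$ where the primes are taken in increasing order. Let $$\Phi(u,v):=\mathbb E\Bigl(\exp\bigl(iu\,\mathrm{Re}\,\mathrm{Ld}(1,\mathbb X)+iv\,\mathrm{Im}\,\mathrm{Ld}(1,\mathbb X)\bigr)\Bigr)\qquad(u,v\in\mathbb R).$$ Then $\Phi$ is integrable on $\mathbb R^2$, and the function $$g(x,y):=\frac1{(2\pi)^2}\int_{-\infty}^\infty\int_{-\infty}^\infty e^{-i(ux+vy)}\Phi(u,v)\,du\,dv$$ is real-valued and infinitely differentiable on $\mathbb R^2$. The joint distribution of $\mathrm{Re}\,\mathrm{Ld}(1,\mathbb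 X)$ and $\mathrm{Im}\,\mathrm{Ld}(1,\mathbb X)$ is absolutely continuous with respect to Lebesgue measure, with density $g$. Moreover $g(x,y)>0$ for all $(x,y)\in\mathbb R^2$. -/

import Mathlib

open MeasureTheory ProbabilityTheory Filter Topology
open scoped ArithmeticFunction.vonMangoldt

namespace RandomLogDeriv

noncomputable section

/-- The uniform probability distribution on the unit circle of `ℂ`: the law of `exp (i θ)`
with `θ` uniform on `(0, 2π]`. -/
def uniformCircle : Measure ℂ :=
  ((ENNReal.ofReal (2 * Real.pi))⁻¹ •
    (volume : Measure ℝ).restrict (Set.Ioc 0 (2 * Real.pi))).map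
      (fun θ : ℝ => Complex.exp (Complex.I * θ))

/-- The completely multiplicative extension `x(n) = ∏ x(p)^a` over the prime powers `p^a`
exactly dividing `n`, of a family `x` of complex numbers indexed by the primes. -/
def multExt (x : Nat.Primes → ℂ) (n : ℕ) : ℂ :=
  ∏ p ∈ n.primeFactors.attach, x ⟨p, Nat.prime_of_mem_primeFactors p.2⟩ ^ n.factorization p

/-- The partial sum `-∑_{1 ≤ n ≤ N} Λ(n) x(n) / n`. -/
def ldPartial (x : Nat.Primes → ℂ) (N : ℕ) : ℂ :=
  -∑ n ∈ Finset.Icc 1 N, ((Λ n : ℝ) : ℂ) * multExt x n / (n : ℂ)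

/-- `Ld(1, x) = -∑_{n ≥ 1} Λ(n) x(n) / n`, the limit of the partial sums in the natural order
(meaningful when that limit exists). -/
def ld (x : Nat.Primes → ℂ) : ℂ :=
  limUnder atTop (ldPartial x)

/-- The partial sum `∑_{p ≤ N} (log p) x(p) / (p - x(p))` over primes. -/
def primePartial (x : Nat.Primes → ℂ) (N : ℕ) : ℂ :=
  ∑ p ∈ (Nat.primesLE N).attach,
    (Real.log (p : ℕ) : ℂ) * x ⟨p, Nat.prime_of_mem_primesLE p.2⟩ /
      (((p : ℕ) : ℂ) - x ⟨p, Nat.prime_of_mem_primesLE p.2⟩)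

variable {Ω : Type*} [MeasurableSpace Ω]

/-- The random variable `Ld(1, X)`. -/
def Ld (X : Nat.Primes → Ω → ℂ) (ω : Ω) : ℂ :=
  ld (fun p => X p ω)

/-- The characteristic function of the joint distribution of `Re Ld(1, X)` and `Im Ld(1, X)`:
`Φ(u, v) = E exp (i u Re Ld(1, X) + i v Im Ld(1, X))`. -/
def Phi (P : Measure Ω) (X : Nat.Primes → Ω → ℂ) (u v : ℝ) : ℂ :=
  ∫ ω, Complex.exp (Complex.I * u * (Ld X ω).re + Complex.I * v * (Ld X ω).im) ∂P

end

end RandomLogDeriv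

/-! Each prime contributes an independent term `primeTerm p (X p)`. It is holomorphic in `X p` on
the closed unit disc and vanishes at 0, so it is centred by the mean value property. Its size is
about log p / p, which is square summable, so martingale convergence gives almost sure convergence
over primes. Higher prime powers contribute an absolutely summable amount, which links this to the
series over integers (`ae_tendsto_Ld`).

The characteristic function at `w` is a product over primes. A factor for which ‖w‖ log p / (p - 1)
is small is at most 1 minus a multiple of that quantity squared (`norm_charFun_map_primeTerm_le`).
Chebyshev's bounds supply enough primes of size about ‖w‖^(3/2) to give decay like exp(-c √‖w‖),
even after finitely many primes are dropped (`exists_norm_charFun_map_ldTail_le`). All moments of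
the characteristic function are therefore finite, and Fourier inversion yields a smooth density.

For positivity, split the sum into its first N terms and a tail. The tail has a continuous density
h, and the density of the whole at z is the mean of h(z - s) over the law of the head. For suitable
large N the tail charges the unit ball, so h(a) > 0 for some ‖a‖ < 1. The head comes near z - a with
positive probability: each term runs over a circle, the radii have divergent sum while the centres
are summable, and sums of such circles fill large discs (`exists_sum_primeTerm_eq`). -/

namespace RandomLogDeriv

/-! ### Fourier inversion for probability measures -/

section Inversion

open scoped FourierTransform ComplexConjugate InnerProductSpace

/-- Reconciles the kernel exp(i⟪x, t⟫) of `charFun` with the kernel exp(2πi⟪s, x⟫) of the Fourier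
transform. -/
theorem charFun_two_pi_smul_eq {E : Type*} [NormedAddCommGroup E] [InnerProductSpace ℝ E]
    [MeasurableSpace E] (μ : Measure E) (s : E) :
    charFun μ ((2 * Real.pi) • s) = ∫ x, Real.fourierChar ⟪s, x⟫_ℝ • (1 : ℂ) ∂μ := by
  rw [charFun_apply]
  congr with x
  rw [Circle.smul_def, Real.fourierChar_apply, inner_smul_right, real_inner_comm]
  simp

variable {E : Type*} [NormedAddCommGroup E] [InnerProductSpace ℝ E] [FiniteDimensional ℝ E]
  [MeasurableSpace E] [BorelSpace E]

/-- The candidate density of `μ`: the Fourier transform of `s ↦ charFun μ (2 π s)`. -/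
noncomputable def invDensity (μ : Measure E) (x : E) : ℂ :=
  𝓕 (fun s : E => charFun μ ((2 * Real.pi) • s)) x

theorem continuous_charFun_two_pi_smul (μ : Measure E) [IsProbabilityMeasure μ] :
    Continuous fun s : E => charFun μ ((2 * Real.pi) • s) := by
  have : Continuous (charFun μ) := by fun_prop
  exact this.comp (by fun_prop)

variable {μ : Measure E}

theorem continuous_invDensity
    (hint : Integrable fun s : E => charFun μ ((2 * Real.pi) • s)) :
    Continuous (invDensity μ) :=
  VectorFourier.fourierIntegral_continuous Real.continuous_fourierChar
    (by simp only [innerₗ_apply_apply]; fun_prop) hint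

theorem conj_invDensity (x : E) : conj (invDensity μ x) = invDensity μ x := by
  rw [invDensity, Real.fourier_eq, ← integral_conj, ← integral_neg_eq_self]
  congr with s
  rw [Circle.smul_def, Circle.smul_def, smul_neg, charFun_neg, smul_eq_mul, map_mul,
    Complex.conj_conj, smul_eq_mul, inner_neg_left, ← Circle.coe_inv_eq_conj, ← AddChar.map_neg_eq_inv,
    neg_neg]

theorem ofReal_re_invDensity (x : E) : ((invDensity μ x).re : ℂ) = invDensity μ x :=
  Complex.conj_eq_iff_re.mp (conj_invDensity x)

variable [IsProbabilityMeasure μ]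

/-- Parseval by moving the Fourier transform across a pairing twice: first between `volume` and `μ`,
after writing `φ` as an inverse transform, then between `volume` and itself. -/
theorem integral_schwartz_eq_integral_mul_invDensity
    (hint : Integrable fun s : E => charFun μ ((2 * Real.pi) • s)) (φ : SchwartzMap E ℂ) :
    ∫ x, φ x ∂μ = ∫ x, φ x * invDensity μ x := by
  have h1 : ∀ x, φ x = VectorFourier.fourierIntegral Real.fourierChar volume (-innerₗ E)
      (𝓕 φ : SchwartzMap E ℂ) x := by
    intro x
    have : φ x = (𝓕⁻ (𝓕 φ : SchwartzMap E ℂ) : SchwartzMap E ℂ) x := by simp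
    rw [this, SchwartzMap.fourierInv_coe, Real.fourierInv_eq]
    simp [VectorFourier.fourierIntegral]
  have hL : Continuous fun p : E × E => (-innerₗ E) p.1 p.2 := by
    simp only [LinearMap.neg_apply, innerₗ_apply_apply]
    fun_prop
  have hL' : Continuous fun p : E × E => (innerₗ E) p.1 p.2 := by
    simp only [innerₗ_apply_apply]
    fun_prop
  have h2 := VectorFourier.integral_fourierIntegral_smul_eq_flip (μ := (volume : Measure E))
    (ν := μ) (f := (𝓕 φ : SchwartzMap E ℂ)) (g := fun _ => (1 : ℂ)) Real.continuous_fourierChar hL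
    (𝓕 φ : SchwartzMap E ℂ).integrable (integrable_const _)
  have h3 := VectorFourier.integral_fourierIntegral_smul_eq_flip (μ := (volume : Measure E))
    (ν := (volume : Measure E)) (f := φ) (g := fun s : E => charFun μ ((2 * Real.pi) • s))
    Real.continuous_fourierChar hL' φ.integrable hint
  calc ∫ x, φ x ∂μ = ∫ x, VectorFourier.fourierIntegral Real.fourierChar volume (-innerₗ E)
          (𝓕 φ : SchwartzMap E ℂ) x • (1 : ℂ) ∂μ := by
        congr with x
        rw [h1 x]; simp
    _ = _ := h2
    _ = ∫ s, VectorFourier.fourierIntegral Real.fourierChar volume (innerₗ E) φ s •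
          charFun μ ((2 * Real.pi) • s) := by
        congr with s
        rw [charFun_two_pi_smul_eq, SchwartzMap.fourier_coe]
        congr 1
        simp only [VectorFourier.fourierIntegral]
        congr with x
        simp
    _ = _ := h3
    _ = _ := by
        congr with x
        rw [flip_innerₗ]
        rfl

theorem integral_eq_integral_mul_re_invDensity
    (hint : Integrable fun s : E => charFun μ ((2 * Real.pi) • s)) {f : E → ℝ}
    (hf : HasCompactSupport f) (hf' : ContDiff ℝ (⊤ : ℕ∞) f) :
    ∫ x, f x ∂μ = ∫ x, f x * (invDensity μ x).re := by
  have hc : HasCompactSupport fun x => (f x : ℂ) := hf.comp_left (g := Complex.ofReal) rfl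
  have hd : ContDiff ℝ (⊤ : ℕ∞) fun x => (f x : ℂ) := Complex.ofRealCLM.contDiff.comp hf'
  have := integral_schwartz_eq_integral_mul_invDensity hint (hc.toSchwartzMap hd)
  simp only [HasCompactSupport.toSchwartzMap_toFun] at this
  have h2 : ∫ x, (f x : ℂ) * invDensity μ x = ∫ x, ((f x * (invDensity μ x).re : ℝ) : ℂ) := by
    congr with x
    rw [Complex.ofReal_mul, ofReal_re_invDensity]
  rw [h2, integral_complex_ofReal, integral_complex_ofReal] at this
  exact_mod_cast this

/-- Were the density negative at `x`, it would be so on a ball by continuity, and a bump supported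
there would have negative integral against `μ`. -/
theorem re_invDensity_nonneg
    (hint : Integrable fun s : E => charFun μ ((2 * Real.pi) • s)) (x : E) :
    0 ≤ (invDensity μ x).re := by
  by_contra! hx
  have hcont : Continuous fun y => (invDensity μ y).re :=
    Complex.continuous_re.comp (continuous_invDensity hint)
  obtain ⟨r, hr, hball⟩ := Metric.isOpen_iff.1 (isOpen_lt hcont continuous_const) x hx
  let b : ContDiffBump x := ⟨r / 2, r, by positivity, by linarith⟩
  have hb : Continuous b := b.continuous
  have heq := integral_eq_integral_mul_re_invDensity hint b.hasCompactSupport b.contDiff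
  have h0 : 0 ≤ ∫ y, b y ∂μ := integral_nonneg fun y => b.nonneg
  have hle : ∀ y, b y * (invDensity μ y).re ≤ 0 := by
    intro y
    by_cases hy : y ∈ Metric.ball x r
    · exact mul_nonpos_of_nonneg_of_nonpos b.nonneg (le_of_lt (hball hy))
    · have : b y = 0 := by
        rw [← Function.notMem_support, b.support_eq]; exact hy
      simp [this]
  have hpos : 0 < ∫ y, -(b y * (invDensity μ y).re) := by
    refine Continuous.integral_pos_of_hasCompactSupport_nonneg_nonzero (by fun_prop)
      (HasCompactSupport.neg b.hasCompactSupport.mul_right) (fun y => by simpa using hle y) (x := x) ?_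
    have : b x = 1 := b.one_of_mem_closedBall (Metric.mem_closedBall_self b.rIn_pos.le)
    simp only [this, one_mul, ne_eq, neg_eq_zero]
    exact hx.ne
  rw [integral_neg] at hpos
  linarith

/-- A bump equal to 1 on a ball shows that the nonnegative density has mass at most 1 there; the
balls exhaust the space. -/
theorem integrable_invDensity
    (hint : Integrable fun s : E => charFun μ ((2 * Real.pi) • s)) :
    Integrable (invDensity μ) := by
  have hcont := continuous_invDensity hint
  refine ⟨hcont.aestronglyMeasurable, ?_⟩
  let b : ℕ → ContDiffBump (0 : E) := fun n => ⟨n + 1, n + 2, by positivity, by linarith⟩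
  have key : ∀ n : ℕ, ∫⁻ x in Metric.closedBall (0 : E) (n + 1), ‖invDensity μ x‖ₑ ≤ 1 := by
    intro n
    have hb : Continuous (b n) := (b n).continuous
    have heq := integral_eq_integral_mul_re_invDensity hint (b n).hasCompactSupport (b n).contDiff
    have hle : ∫ y, b n y ∂μ ≤ 1 := by
      refine (integral_mono_of_nonneg (ae_of_all _ fun y => (b n).nonneg) (integrable_const 1)
        (ae_of_all _ fun y => (b n).le_one)).trans ?_
      simp
    have hcr : Continuous fun y => (invDensity μ y).re := Complex.continuous_re.comp hcont
    calc ∫⁻ x in Metric.closedBall (0 : E) (n + 1), ‖invDensity μ x‖ₑ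
        ≤ ∫⁻ x in Metric.closedBall (0 : E) (n + 1), ENNReal.ofReal (b n x * (invDensity μ x).re) := by
          refine setLIntegral_mono' measurableSet_closedBall fun x hx => ?_
          rw [(b n).one_of_mem_closedBall hx, one_mul, ← ofReal_re_invDensity,
            ← ofReal_norm, Complex.norm_real, Real.norm_of_nonneg (re_invDensity_nonneg hint x)]
          simp
      _ ≤ ∫⁻ x, ENNReal.ofReal (b n x * (invDensity μ x).re) := setLIntegral_le_lintegral _ _
      _ = ENNReal.ofReal (∫ x, b n x * (invDensity μ x).re) := by
          rw [ofReal_integral_eq_lintegral_ofReal]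
          · exact (by fun_prop : Continuous _).integrable_of_hasCompactSupport
              (b n).hasCompactSupport.mul_right
          · exact ae_of_all _ fun y => mul_nonneg (b n).nonneg (re_invDensity_nonneg hint y)
      _ ≤ 1 := by rw [← heq]; simpa using hle
  have hU : (Set.univ : Set E) = ⋃ n : ℕ, Metric.closedBall (0 : E) (n + 1) := by
    refine (Set.eq_univ_of_forall fun x => ?_).symm
    obtain ⟨n, hn⟩ := exists_nat_ge ‖x‖
    exact Set.mem_iUnion.2 ⟨n, by rw [mem_closedBall_zero_iff]; linarith⟩
  rw [hasFiniteIntegral_iff_enorm, ← setLIntegral_univ, hU, setLIntegral_iUnion_of_directed]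
  · exact (iSup_le key).trans_lt ENNReal.one_lt_top
  · exact (monotone_nat_of_le_succ fun n => Metric.closedBall_subset_closedBall
      (by push_cast; linarith)).directed_le

/-- Fourier inversion for probability measures with integrable characteristic function. -/
theorem eq_withDensity_invDensity
    (hint : Integrable fun s : E => charFun μ ((2 * Real.pi) • s)) :
    μ = volume.withDensity fun x => ENNReal.ofReal (invDensity μ x).re := by
  have hcont := continuous_invDensity hint
  have hcr : Continuous fun y => (invDensity μ y).re := Complex.continuous_re.comp hcont
  have hI := integrable_invDensity hint
  have hfin : IsFiniteMeasure (volume.withDensity fun x => ENNReal.ofReal (invDensity μ x).re) :=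
    isFiniteMeasure_withDensity_ofReal hI.re.2
  -- With the transform now known to be integrable, inversion holds at every point, so both measures
  -- have the same characteristic function.
  have hinv := (continuous_charFun_two_pi_smul μ).fourierInv_fourier_eq hint hI
  refine Measure.ext_of_charFun (funext fun t => ?_)
  have ht : t = (2 * Real.pi) • ((2 * Real.pi)⁻¹ • t) := by
    rw [smul_smul, mul_inv_cancel₀ (by positivity), one_smul]
  rw [ht, ← congrFun hinv, Real.fourierInv_eq, charFun_two_pi_smul_eq,
    integral_withDensity_eq_integral_toReal_smul (by fun_prop) (by simp)]
  congr with x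
  rw [ENNReal.toReal_ofReal (re_invDensity_nonneg hint x), real_inner_comm, Circle.smul_def,
    Circle.smul_def, Complex.real_smul, ofReal_re_invDensity, smul_eq_mul, smul_eq_mul, mul_one,
    mul_comm]
  rfl

end Inversion

/-! ### Almost sure convergence of independent centred series -/

section RandomSeries

variable {Ω : Type*} [MeasurableSpace Ω] {P : Measure Ω} [IsProbabilityMeasure P]

/-- A series of independent centred bounded real random variables whose bounds are square summable
converges almost surely. -/
theorem ae_exists_tendsto_sum_of_iIndepFun {ξ : ℕ → Ω → ℝ} (hm : ∀ k, Measurable (ξ k))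
    (hindep : iIndepFun ξ P) (hmean : ∀ k, ∫ ω, ξ k ω ∂P = 0) {a : ℕ → ℝ}
    (hb : ∀ k, ∀ᵐ ω ∂P, |ξ k ω| ≤ a k) (ha : Summable fun k => a k ^ 2) :
    ∀ᵐ ω ∂P, ∃ c, Tendsto (fun n => ∑ k ∈ Finset.range n, ξ k ω) atTop (𝓝 c) := by
  have hsm : ∀ k, StronglyMeasurable (ξ k) := fun k => (hm k).stronglyMeasurable
  have hL2 : ∀ k, MemLp (ξ k) 2 P := fun k =>
    MemLp.of_bound (hm k).aestronglyMeasurable (a k) (hb k)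
  have hint : ∀ k, Integrable (ξ k) P := fun k => (hL2 k).integrable (by norm_num)
  -- The range `n + 1` includes `ξ n`, matching the natural filtration at time `n`.
  let M : ℕ → Ω → ℝ := fun n => ∑ k ∈ Finset.range (n + 1), ξ k
  have hMint : ∀ n, Integrable (M n) P := fun n => integrable_finsetSum' _ fun k _ => hint k
  have hadp : StronglyAdapted (Filtration.natural ξ hsm) M := fun n =>
    Finset.stronglyMeasurable_sum _ fun k hk =>
      ((Filtration.stronglyAdapted_natural hsm k).mono
        ((Filtration.natural ξ hsm).mono (Nat.lt_succ_iff.1 (Finset.mem_range.1 hk))))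
  have hmart : Martingale M (Filtration.natural ξ hsm) P := by
    refine martingale_nat hadp hMint fun n => ?_
    have h1 : M (n + 1) = M n + ξ (n + 1) := Finset.sum_range_succ _ _
    rw [h1]
    have h2 := condExp_add (hMint n) (hint (n + 1)) (Filtration.natural ξ hsm n)
    have h3 := hindep.condExp_natural_ae_eq_of_lt hsm (Nat.lt_succ_self n)
    have h4 := condExp_of_stronglyMeasurable ((Filtration.natural ξ hsm).le n) (hadp n) (hMint n)
    filter_upwards [h2, h3] with ω h2 h3
    simp only [Nat.succ_eq_add_one] at h3
    rw [h2, Pi.add_apply, h4, h3, hmean, add_zero]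
  have hvar : ∀ n, ∫ ω, M n ω ^ 2 ∂P ≤ ∑' k, a k ^ 2 := by
    intro n
    have hM0 : ∫ ω, M n ω ∂P = 0 := by
      simp only [M, Finset.sum_apply]
      rw [integral_finsetSum _ fun k _ => hint k]
      exact Finset.sum_eq_zero fun k _ => hmean k
    rw [← variance_of_integral_eq_zero (hMint n).aemeasurable hM0, IndepFun.variance_sum
      (fun k _ => hL2 k) (fun i _ j _ hij => hindep.indepFun hij)]
    refine le_trans (Finset.sum_le_sum fun k _ => ?_) (ha.sum_le_tsum _ fun k _ => sq_nonneg _)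
    rw [variance_of_integral_eq_zero (hm k).aemeasurable (hmean k)]
    refine (integral_mono_ae (hL2 k).integrable_sq (integrable_const (a k ^ 2)) ?_).trans (by simp)
    filter_upwards [hb k] with ω hω
    exact sq_le_sq.2 (hω.trans (le_abs_self _))
  have hbdd : ∀ n, eLpNorm (M n) 1 P ≤ (Real.toNNReal (1 + ∑' k, a k ^ 2) : NNReal) := by
    intro n
    have hsq : Integrable (fun ω => M n ω ^ 2) P :=
      (memLp_finsetSum' _ fun k _ => hL2 k : MemLp (M n) 2 P).integrable_sq
    rw [eLpNorm_one_eq_lintegral_enorm, ← ofReal_integral_norm_eq_lintegral_enorm (hMint n)]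
    refine ENNReal.ofReal_le_ofReal ?_
    -- The variance bound becomes the L¹ bound needed for martingale convergence.
    calc ∫ ω, ‖M n ω‖ ∂P ≤ ∫ ω, (1 + M n ω ^ 2) ∂P :=
          integral_mono (hMint n).norm ((integrable_const 1).add hsq) fun ω => by
            simp only [Real.norm_eq_abs]
            nlinarith [sq_nonneg (|M n ω| - 1), sq_abs (M n ω)]
      _ ≤ 1 + ∑' k, a k ^ 2 := by
          rw [integral_add (integrable_const 1) hsq]
          simpa using hvar n
  filter_upwards [hmart.submartingale.exists_ae_tendsto_of_bdd hbdd] with ω hω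
  obtain ⟨c, hc⟩ := hω
  refine ⟨c, (tendsto_add_atTop_iff_nat 1).1 ?_⟩
  simpa [M, Finset.sum_apply] using hc

/-- Complex version of `ae_exists_tendsto_sum_of_iIndepFun`. -/
theorem ae_exists_tendsto_sum_of_iIndepFun_complex {ξ : ℕ → Ω → ℂ} (hm : ∀ k, Measurable (ξ k))
    (hindep : iIndepFun ξ P) (hmean : ∀ k, ∫ ω, ξ k ω ∂P = 0) {a : ℕ → ℝ}
    (hb : ∀ k, ∀ᵐ ω ∂P, ‖ξ k ω‖ ≤ a k) (ha : Summable fun k => a k ^ 2) :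
    ∀ᵐ ω ∂P, ∃ c, Tendsto (fun n => ∑ k ∈ Finset.range n, ξ k ω) atTop (𝓝 c) := by
  have hint : ∀ k, Integrable (ξ k) P := fun k =>
    Integrable.of_bound (hm k).aestronglyMeasurable (a k) (hb k)
  have hre := ae_exists_tendsto_sum_of_iIndepFun (P := P) (ξ := fun k ω => (ξ k ω).re) (a := a)
    (fun k => Complex.measurable_re.comp (hm k))
    (hindep.comp (fun _ => Complex.re) fun _ => Complex.measurable_re)
    (fun k => by
      have := integral_re (𝕜 := ℂ) (hint k)
      simpa [hmean k] using this)
    (fun k => (hb k).mono fun ω h => (Complex.abs_re_le_norm _).trans h) ha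
  have him := ae_exists_tendsto_sum_of_iIndepFun (P := P) (ξ := fun k ω => (ξ k ω).im) (a := a)
    (fun k => Complex.measurable_im.comp (hm k))
    (hindep.comp (fun _ => Complex.im) fun _ => Complex.measurable_im)
    (fun k => by
      have := integral_im (𝕜 := ℂ) (hint k)
      simpa [hmean k] using this)
    (fun k => (hb k).mono fun ω h => (Complex.abs_im_le_norm _).trans h) ha
  filter_upwards [hre, him] with ω ⟨c, hc⟩ ⟨d, hd⟩
  refine ⟨⟨c, d⟩, ?_⟩
  have h1 := ((Complex.continuous_ofReal.tendsto c).comp hc).add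
    (((Complex.continuous_ofReal.tendsto d).comp hd).mul_const Complex.I)
  rw [Complex.mk_eq_add_mul_I]
  refine h1.congr fun n => ?_
  apply Complex.ext <;> simp

end RandomSeries

/-! ### The uniform law on the circle and the term of one prime -/

section CircleLaw

open scoped ComplexConjugate InnerProductSpace

theorem measurable_exp_I_mul : Measurable fun θ : ℝ => Complex.exp (Complex.I * θ) := by
  fun_prop

theorem uniformCircle_apply {s : Set ℂ} (hs : MeasurableSet s) :
    uniformCircle s = (ENNReal.ofReal (2 * Real.pi))⁻¹ *
      volume (((fun θ : ℝ => Complex.exp (Complex.I * θ)) ⁻¹' s) ∩ Set.Ioc 0 (2 * Real.pi)) := by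
  rw [uniformCircle, Measure.map_apply measurable_exp_I_mul hs, Measure.smul_apply,
    Measure.restrict_apply (measurable_exp_I_mul hs), smul_eq_mul]

instance isProbabilityMeasure_uniformCircle : IsProbabilityMeasure uniformCircle := by
  refine ⟨?_⟩
  rw [uniformCircle_apply MeasurableSet.univ, Set.preimage_univ, Set.univ_inter, Real.volume_Ioc,
    sub_zero]
  exact ENNReal.inv_mul_cancel (by simp [Real.pi_pos]) ENNReal.ofReal_ne_top

theorem ae_norm_eq_one_uniformCircle : ∀ᵐ z ∂uniformCircle, ‖z‖ = 1 := by
  rw [uniformCircle, ae_map_iff measurable_exp_I_mul.aemeasurable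
    (measurableSet_eq_fun measurable_norm measurable_const)]
  exact ae_of_all _ fun θ => by rw [mul_comm, Complex.norm_exp_ofReal_mul_I]

theorem integral_uniformCircle_eq_circleAverage {f : ℂ → ℂ} (hf : Measurable f) :
    ∫ z, f z ∂uniformCircle = Real.circleAverage f 0 1 := by
  rw [uniformCircle, integral_map measurable_exp_I_mul.aemeasurable hf.aestronglyMeasurable,
    integral_smul_measure, Real.circleAverage, intervalIntegral.integral_of_le (by positivity),
    ENNReal.toReal_inv, ENNReal.toReal_ofReal (by positivity)]
  congr 2 with θ
  simp [circleMap, mul_comm]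

theorem uniformCircle_pos_of_isOpen {U : Set ℂ} (hU : IsOpen U) {z : ℂ} (hz : ‖z‖ = 1)
    (hzU : z ∈ U) : 0 < uniformCircle U := by
  rw [uniformCircle_apply hU.measurableSet]
  refine ENNReal.mul_pos (ENNReal.inv_ne_zero.2 ENNReal.ofReal_ne_top) (ne_of_gt ?_)
  let V := (fun θ : ℝ => Complex.exp (Complex.I * θ)) ⁻¹' U
  have hV : IsOpen V := hU.preimage (by fun_prop)
  let θ := toIocMod Real.two_pi_pos 0 z.arg
  have hθ : θ ∈ Set.Ioc 0 (2 * Real.pi) := by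
    simpa using toIocMod_mem_Ioc Real.two_pi_pos 0 z.arg
  have hθV : θ ∈ V := by
    have h1 : Complex.exp (Complex.I * (z.arg : ℝ)) = z := by
      have := Complex.norm_mul_exp_arg_mul_I z
      rwa [hz, Complex.ofReal_one, one_mul, mul_comm] at this
    have h2 : Complex.exp (Complex.I * (θ : ℝ)) = z := by
      rw [← h1]
      have h3 : (z.arg : ℂ) = θ + toIocDiv Real.two_pi_pos 0 z.arg * (2 * Real.pi) := by
        exact_mod_cast (zsmul_eq_mul (2 * Real.pi) _) ▸
          (toIocMod_add_toIocDiv_zsmul Real.two_pi_pos 0 z.arg).symm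
      rw [Complex.exp_eq_exp_iff_exists_int]
      refine ⟨-toIocDiv Real.two_pi_pos 0 z.arg, ?_⟩
      push_cast
      linear_combination -Complex.I * h3
    change Complex.exp (Complex.I * (θ : ℝ)) ∈ U
    rwa [h2]
  -- The angle may be the endpoint 2π, so the open set `V` is met inside the open interval through
  -- its closure.
  have hcl : θ ∈ closure (Set.Ioo 0 (2 * Real.pi)) := by
    rw [closure_Ioo Real.two_pi_pos.ne]
    exact Set.Ioc_subset_Icc_self hθ
  have hne : (V ∩ Set.Ioo 0 (2 * Real.pi)).Nonempty := mem_closure_iff.1 hcl V hV hθV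
  exact ((hV.inter isOpen_Ioo).measure_pos volume hne).trans_le
    (measure_mono (Set.inter_subset_inter_right _ Set.Ioo_subset_Ioc_self))

/-- If a centred real random variable is bounded by a small `δ` and has variance at least
`δ ^ 2 / 8`, then its characteristic function at `1` is bounded away from `1`. -/
theorem norm_integral_exp_le {Ω : Type*} [MeasurableSpace Ω] {P : Measure Ω}
    [IsProbabilityMeasure P] {ξ : Ω → ℝ} (hm : Measurable ξ) {δ : ℝ} (hδ : 0 ≤ δ)
    (hδ' : δ ≤ 1 / 8) (hb : ∀ᵐ ω ∂P, |ξ ω| ≤ δ) (hmean : ∫ ω, ξ ω ∂P = 0)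
    (hvar : δ ^ 2 / 8 ≤ ∫ ω, ξ ω ^ 2 ∂P) :
    ‖∫ ω, Complex.exp (ξ ω * Complex.I) ∂P‖ ≤ 1 - δ ^ 2 / 32 := by
  have hL2 : MemLp ξ 2 P := MemLp.of_bound hm.aestronglyMeasurable δ hb
  have hint : Integrable ξ P := hL2.integrable (by norm_num)
  have hsq : Integrable (fun ω => ξ ω ^ 2) P := hL2.integrable_sq
  have hexp : Integrable (fun ω => Complex.exp (ξ ω * Complex.I)) P :=
    Integrable.of_bound (by fun_prop) 1 (ae_of_all _ fun ω => by
      rw [Complex.norm_exp_ofReal_mul_I])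
  -- The second-order Taylor polynomial of the exponential; its remainder is cubic in `δ`.
  let q : Ω → ℂ := fun ω => 1 + ξ ω * Complex.I - ((ξ ω ^ 2 : ℝ) : ℂ) / 2
  have hq : Integrable q P := ((integrable_const 1).add (hint.ofReal.mul_const _)).sub
    (hsq.ofReal.div_const 2)
  have hqint : ∫ ω, q ω ∂P = ((1 - (∫ ω, ξ ω ^ 2 ∂P) / 2 : ℝ) : ℂ) := by
    simp only [q]
    rw [integral_sub ((integrable_const 1).add (hint.ofReal.mul_const _))
      (hsq.ofReal.div_const 2), integral_add (integrable_const 1) (hint.ofReal.mul_const _),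
      integral_mul_const, integral_div, integral_complex_ofReal, integral_complex_ofReal, hmean]
    simp
  have hvar' : ∫ ω, ξ ω ^ 2 ∂P ≤ δ ^ 2 := by
    refine (integral_mono_ae hsq (integrable_const (δ ^ 2)) ?_).trans (by simp)
    filter_upwards [hb] with ω hω
    exact sq_le_sq.2 (hω.trans (le_abs_self _))
  have hdiff : ‖∫ ω, (Complex.exp (ξ ω * Complex.I) - q ω) ∂P‖ ≤ 2 / 9 * δ ^ 3 := by
    refine (norm_integral_le_of_norm_le_const (C := 2 / 9 * δ ^ 3) ?_).trans (by simp)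
    filter_upwards [hb] with ω hω
    have hn : ‖(ξ ω : ℂ) * Complex.I‖ = |ξ ω| := by simp
    have h := Complex.exp_bound (x := ξ ω * Complex.I) (by rw [hn]; linarith) (n := 3) (by norm_num)
    rw [hn] at h
    have hq' : ∑ m ∈ Finset.range 3, ((ξ ω : ℂ) * Complex.I) ^ m / (m.factorial : ℂ) = q ω := by
      simp only [Finset.sum_range_succ, Finset.sum_range_zero, q, mul_pow, Complex.I_sq]
      push_cast [Nat.factorial]
      ring
    rw [hq'] at h
    refine h.trans ?_
    have : |ξ ω| ^ 3 ≤ δ ^ 3 := pow_le_pow_left₀ (abs_nonneg _) hω 3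
    norm_num [Nat.factorial]
    linarith
  rw [integral_sub hexp hq, hqint] at hdiff
  have hn : ‖((1 - (∫ ω, ξ ω ^ 2 ∂P) / 2 : ℝ) : ℂ)‖ = 1 - (∫ ω, ξ ω ^ 2 ∂P) / 2 := by
    rw [Complex.norm_real, Real.norm_of_nonneg]
    nlinarith
  have := norm_le_norm_add_norm_sub' (∫ ω, Complex.exp (ξ ω * Complex.I) ∂P)
    ((1 - (∫ ω, ξ ω ^ 2 ∂P) / 2 : ℝ) : ℂ)
  rw [hn] at this
  -- The loss δ²/16 exceeds the remainder 2δ³/9 ≤ δ²/36 by at least δ²/32.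
  nlinarith [mul_le_mul_of_nonneg_left hδ' (sq_nonneg δ)]

/-- The contribution `-(log p) z / (p - z)` of the prime `p` to `Ld(1, x)`, where `z = x(p)`. -/
noncomputable def primeTerm (p : ℕ) (z : ℂ) : ℂ := -((Real.log p : ℂ) * z / (p - z))

theorem measurable_primeTerm (p : ℕ) : Measurable (primeTerm p) := by
  unfold primeTerm
  fun_prop

theorem sub_ne_zero_of_norm_le_one {p : ℕ} (hp : 2 ≤ p) {z : ℂ} (hz : ‖z‖ ≤ 1) :
    (p : ℂ) - z ≠ 0 := by
  intro h
  rw [sub_eq_zero] at h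
  rw [← h, Complex.norm_natCast] at hz
  have : (2 : ℝ) ≤ p := by exact_mod_cast hp
  linarith

theorem norm_primeTerm_le {p : ℕ} (hp : 2 ≤ p) {z : ℂ} (hz : ‖z‖ = 1) :
    ‖primeTerm p z‖ ≤ Real.log p / (p - 1) := by
  have hp' : (2 : ℝ) ≤ p := by exact_mod_cast hp
  have hl : 0 ≤ Real.log p := Real.log_nonneg (by linarith)
  rw [primeTerm, norm_neg, norm_div, norm_mul, hz, mul_one, Complex.norm_real,
    Real.norm_of_nonneg hl]
  refine div_le_div_of_nonneg_left hl (by linarith) ?_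
  have := norm_sub_norm_le (p : ℂ) z
  rwa [hz, Complex.norm_natCast] at this

theorem le_norm_primeTerm {p : ℕ} (hp : 2 ≤ p) {z : ℂ} (hz : ‖z‖ = 1) :
    Real.log p / (p + 1) ≤ ‖primeTerm p z‖ := by
  have hp' : (2 : ℝ) ≤ p := by exact_mod_cast hp
  have hl : 0 ≤ Real.log p := Real.log_nonneg (by linarith)
  rw [primeTerm, norm_neg, norm_div, norm_mul, hz, mul_one, Complex.norm_real,
    Real.norm_of_nonneg hl]
  refine div_le_div_of_nonneg_left hl
    (norm_pos_iff.2 (sub_ne_zero_of_norm_le_one hp hz.le)) ?_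
  have := norm_sub_le (p : ℂ) z
  rwa [hz, Complex.norm_natCast] at this

theorem differentiableAt_primeTerm {p : ℕ} (hp : 2 ≤ p) {z : ℂ} (hz : ‖z‖ ≤ 1) :
    DifferentiableAt ℂ (primeTerm p) z := by
  unfold primeTerm
  have := sub_ne_zero_of_norm_le_one hp hz
  fun_prop (disch := assumption)

/-- The mean value property: the pole at `p` lies outside the closed disc and the value at 0
vanishes. The case `n = 1` centres the terms; `n = 2` serves the variance. -/
theorem integral_primeTerm_pow {p : ℕ} (hp : 2 ≤ p) {n : ℕ} (hn : n ≠ 0) :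
    ∫ z, primeTerm p z ^ n ∂uniformCircle = 0 := by
  rw [integral_uniformCircle_eq_circleAverage ((measurable_primeTerm p).pow_const n)]
  have hd : DifferentiableOn ℂ (fun z => primeTerm p z ^ n) (Metric.closedBall 0 1) :=
    fun z hz => ((differentiableAt_primeTerm hp (by simpa using hz)).pow n).differentiableWithinAt
  rw [DiffContOnCl.circleAverage]
  · simp [primeTerm, hn]
  · rw [abs_one]
    exact hd.diffContOnCl_ball subset_rfl

theorem integral_inner_primeTerm {p : ℕ} (hp : 2 ≤ p) (w : ℂ) :
    ∫ z, ⟪primeTerm p z, w⟫_ℝ ∂uniformCircle = 0 := by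
  have hb : Integrable (primeTerm p) uniformCircle :=
    Integrable.of_bound (measurable_primeTerm p).aestronglyMeasurable (Real.log p / (p - 1))
      (ae_norm_eq_one_uniformCircle.mono fun z hz => norm_primeTerm_le hp hz)
  simp_rw [real_inner_comm w]
  rw [integral_inner hb w]
  have := integral_primeTerm_pow hp one_ne_zero
  simp only [pow_one] at this
  rw [this, inner_zero_right]

/-- The squared inner product splits into ‖w‖²‖·‖²/2 and the real part of a multiple of the
holomorphic square, whose mean is zero. Hence the variance is comparable in every direction. -/
theorem le_integral_inner_primeTerm_sq {p : ℕ} (hp : 3 ≤ p) (w : ℂ) :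
    (‖w‖ * (Real.log p / (p - 1))) ^ 2 / 8 ≤ ∫ z, ⟪primeTerm p z, w⟫_ℝ ^ 2 ∂uniformCircle := by
  have hp2 : 2 ≤ p := by omega
  have hp' : (3 : ℝ) ≤ p := by exact_mod_cast hp
  have hl : 0 ≤ Real.log p := Real.log_nonneg (by linarith)
  have hb := ae_norm_eq_one_uniformCircle.mono fun z hz => norm_primeTerm_le hp2 hz
  have hm := measurable_primeTerm p
  have hsq : Integrable (fun z => primeTerm p z ^ 2) uniformCircle :=
    Integrable.of_bound (hm.pow_const 2).aestronglyMeasurable ((Real.log p / (p - 1)) ^ 2)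
      (hb.mono fun z hz => by rw [norm_pow]; exact pow_le_pow_left₀ (norm_nonneg _) hz 2)
  have hsqn : Integrable (fun z => ‖primeTerm p z‖ ^ 2) uniformCircle := by
    simpa only [norm_pow] using hsq.norm
  have hpt : ∀ z, ⟪primeTerm p z, w⟫_ℝ ^ 2 =
      ‖w‖ ^ 2 / 2 * ‖primeTerm p z‖ ^ 2 + ((conj w) ^ 2 / 2 * primeTerm p z ^ 2).re := by
    intro z
    rw [Complex.inner, ← Complex.normSq_eq_norm_sq, ← Complex.normSq_eq_norm_sq]
    simp only [Complex.normSq_apply, Complex.mul_re, Complex.conj_re, Complex.conj_im, pow_two,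
      Complex.mul_im, Complex.div_ofNat_re, Complex.div_ofNat_im]
    ring
  have hI : ∫ z, ⟪primeTerm p z, w⟫_ℝ ^ 2 ∂uniformCircle =
      ‖w‖ ^ 2 / 2 * ∫ z, ‖primeTerm p z‖ ^ 2 ∂uniformCircle := by
    simp_rw [hpt]
    have hre : Integrable (fun z => ((conj w) ^ 2 / 2 * primeTerm p z ^ 2).re) uniformCircle :=
      (hsq.const_mul ((conj w) ^ 2 / 2)).re
    rw [integral_add (hsqn.const_mul _) hre, integral_const_mul]
    have := integral_re (𝕜 := ℂ) (hsq.const_mul ((conj w) ^ 2 / 2))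
    rw [integral_const_mul, integral_primeTerm_pow hp2 two_ne_zero] at this
    simp only [RCLike.re_to_complex, mul_zero, Complex.zero_re] at this
    rw [this, add_zero]
  have hlow : (Real.log p / (p + 1)) ^ 2 ≤ ∫ z, ‖primeTerm p z‖ ^ 2 ∂uniformCircle := by
    have : ∫ _, (Real.log p / (p + 1)) ^ 2 ∂uniformCircle ≤
        ∫ z, ‖primeTerm p z‖ ^ 2 ∂uniformCircle := by
      refine integral_mono_ae (integrable_const _) hsqn ?_
      filter_upwards [ae_norm_eq_one_uniformCircle] with z hz
      exact pow_le_pow_left₀ (by positivity) (le_norm_primeTerm hp2 hz) 2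
    simpa using this
  -- This is p + 1 ≤ 2(p - 1), which is where `3 ≤ p` is needed.
  have hcmp : Real.log p / (p - 1) ≤ 2 * (Real.log p / (p + 1)) := by
    rw [← mul_div_assoc, div_le_div_iff₀ (by linarith) (by linarith)]
    nlinarith
  have hnn : 0 ≤ Real.log p / (p - 1) := div_nonneg hl (by linarith)
  rw [hI]
  have h4 : (Real.log p / (p - 1)) ^ 2 ≤ 4 * ∫ z, ‖primeTerm p z‖ ^ 2 ∂uniformCircle := by
    nlinarith [pow_le_pow_left₀ hnn hcmp 2]
  rw [mul_pow]
  nlinarith [mul_le_mul_of_nonneg_left h4 (sq_nonneg ‖w‖)]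

theorem norm_charFun_map_primeTerm_le {p : ℕ} (hp : 3 ≤ p) {w : ℂ}
    (hw : ‖w‖ * (Real.log p / (p - 1)) ≤ 1 / 8) :
    ‖charFun (uniformCircle.map (primeTerm p)) w‖ ≤
      1 - (‖w‖ * (Real.log p / (p - 1))) ^ 2 / 32 := by
  have hp2 : 2 ≤ p := by omega
  have hp' : (3 : ℝ) ≤ p := by exact_mod_cast hp
  have hm := measurable_primeTerm p
  rw [charFun_apply, integral_map hm.aemeasurable (by fun_prop)]
  refine norm_integral_exp_le (hm.inner_const) (mul_nonneg (norm_nonneg _) (div_nonneg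
    (Real.log_nonneg (by linarith)) (by linarith))) hw ?_ (integral_inner_primeTerm hp2 w)
    (le_integral_inner_primeTerm_sq hp w)
  filter_upwards [ae_norm_eq_one_uniformCircle] with z hz
  refine (abs_real_inner_le_norm _ _).trans ?_
  rw [mul_comm]
  exact mul_le_mul_of_nonneg_left (norm_primeTerm_le hp2 hz) (norm_nonneg _)

end CircleLaw

/-! ### From the series over primes to the series over integers -/

section Rearrangement

variable {x : Nat.Primes → ℂ}

/-- The extension of `x` to all natural numbers by `1`. -/
def extendOne (x : Nat.Primes → ℂ) (n : ℕ) : ℂ :=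
  if h : n.Prime then x ⟨n, h⟩ else 1

theorem extendOne_prime (p : Nat.Primes) : extendOne x p = x p :=
  dif_pos p.2

theorem norm_extendOne (hx : ∀ p, ‖x p‖ = 1) (n : ℕ) : ‖extendOne x n‖ = 1 := by
  unfold extendOne
  split_ifs
  exacts [hx _, norm_one]

theorem multExt_eq_prod (n : ℕ) :
    multExt x n = ∏ p ∈ n.primeFactors, extendOne x p ^ n.factorization p := by
  rw [multExt,
    ← Finset.prod_attach n.primeFactors fun p => extendOne x p ^ n.factorization p]
  refine Finset.prod_congr rfl fun p _ => ?_
  rw [extendOne, dif_pos (Nat.prime_of_mem_primeFactors p.2)]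

theorem norm_multExt (hx : ∀ p, ‖x p‖ = 1) (n : ℕ) : ‖multExt x n‖ = 1 := by
  rw [multExt_eq_prod, norm_prod]
  exact Finset.prod_eq_one fun p _ => by rw [norm_pow, norm_extendOne hx, one_pow]

theorem multExt_prime_pow (p : Nat.Primes) (k : ℕ) :
    multExt x ((p : ℕ) ^ (k + 1)) = x p ^ (k + 1) := by
  rw [multExt_eq_prod, Nat.primeFactors_prime_pow k.succ_ne_zero p.2, Finset.prod_singleton,
    p.2.factorization_pow, Finsupp.single_eq_same, extendOne_prime]

/-- The `n`-th term of the series defining `-Ld(1, x)`. -/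
noncomputable def ldTerm (x : Nat.Primes → ℂ) (n : ℕ) : ℂ :=
  ((Λ n : ℝ) : ℂ) * multExt x n / (n : ℂ)

theorem ldTerm_prime_pow (p : Nat.Primes) (k : ℕ) :
    ldTerm x ((p : ℕ) ^ (k + 1)) = (Real.log (p : ℕ) : ℂ) * (x p / (p : ℕ)) ^ (k + 1) := by
  rw [ldTerm, multExt_prime_pow, ArithmeticFunction.vonMangoldt_apply_pow k.succ_ne_zero,
    ArithmeticFunction.vonMangoldt_apply_prime p.2, div_pow]
  push_cast
  ring

theorem summable_ldTerm_nonprime (hx : ∀ p, ‖x p‖ = 1) :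
    Summable fun n : ℕ => if n.Prime then 0 else ldTerm x n := by
  -- Modulus 1 makes the residue class all of `ℕ`.
  refine Summable.of_norm_bounded
    (ArithmeticFunction.vonMangoldt.summable_residueClass_non_primes_div (q := 1) (a := 0))
    fun n => ?_
  split_ifs with h
  · simp
  · rw [ldTerm, norm_div, norm_mul, norm_multExt hx, mul_one, Complex.norm_natCast,
      Complex.norm_real, Real.norm_of_nonneg ArithmeticFunction.vonMangoldt_nonneg,
      ArithmeticFunction.vonMangoldt.residueClass, Set.indicator_of_mem]
    exact Subsingleton.elim _ _

/-- The contribution of the higher powers of the prime `p`. -/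
noncomputable def primePowerTail (x : Nat.Primes → ℂ) (p : Nat.Primes) : ℂ :=
  (Real.log (p : ℕ) : ℂ) * (x p / (p : ℕ)) ^ 2 * (1 - x p / (p : ℕ))⁻¹

/-- Only prime powers contribute; absolute summability allows grouping them by their prime, and each
group is a geometric series. -/
theorem hasSum_primePowerTail (hx : ∀ p, ‖x p‖ = 1) :
    HasSum (primePowerTail x) (∑' n : ℕ, if n.Prime then 0 else ldTerm x n) := by
  have h1 := (summable_ldTerm_nonprime hx).hasSum
  have hsupp : Function.support (fun n : ℕ => if n.Prime then 0 else ldTerm x n) ⊆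
      {n | IsPrimePow n} := by
    intro n hn
    by_contra hpp
    refine hn ?_
    have : Λ n = 0 := ArithmeticFunction.vonMangoldt_eq_zero_iff.2 hpp
    simp [ldTerm, this]
  rw [← hasSum_subtype_iff_of_support_subset hsupp] at h1
  refine (Nat.Primes.prodNatEquiv.hasSum_iff.2 h1).prod_fiberwise fun p => ?_
  have hp : (1 : ℝ) < (p : ℕ) := by exact_mod_cast p.2.one_lt
  have hnorm : ‖x p / (p : ℕ)‖ < 1 := by
    rw [norm_div, hx, Complex.norm_natCast, div_lt_one (by linarith)]
    exact hp
  have hgeo := (hasSum_geometric_of_norm_lt_one hnorm).mul_left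
    ((Real.log (p : ℕ) : ℂ) * (x p / (p : ℕ)) ^ 2)
  -- The index-0 entry of each fibre is the prime itself, where the summand is 0; the geometric
  -- series starts at the square.
  rw [← hasSum_nat_add_iff' 1]
  simp only [Finset.sum_range_one, Function.comp_apply, Nat.Primes.prodNatEquiv_apply, zero_add,
    pow_one, p.2, if_true, sub_zero]
  refine hgeo.congr_fun fun k => ?_
  rw [if_neg (Nat.Prime.not_prime_pow (by omega)), ldTerm_prime_pow]
  ring

/-- Sums over the primes up to `N` as sums of a function on `ℕ` supported on primes. -/
theorem sum_primesLE_attach (f : Nat.Primes → ℂ) (N : ℕ) :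
    ∑ p ∈ (Nat.primesLE N).attach, f ⟨p, Nat.prime_of_mem_primesLE p.2⟩ =
      ∑ n ∈ Finset.range (N + 1), if h : n.Prime then f ⟨n, h⟩ else 0 := by
  have h1 : ∑ n ∈ Finset.range (N + 1), (if h : n.Prime then f ⟨n, h⟩ else 0) =
      ∑ n ∈ Nat.primesLE N, if h : n.Prime then f ⟨n, h⟩ else 0 := by
    rw [Nat.primesLE_eq_filter_range, Finset.sum_filter]
    refine Finset.sum_congr rfl fun n _ => ?_
    split_ifs <;> rfl
  rw [h1, ← Finset.sum_attach (Nat.primesLE N) fun n => if h : n.Prime then f ⟨n, h⟩ else 0]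
  refine Finset.sum_congr rfl fun p _ => ?_
  rw [dif_pos (Nat.prime_of_mem_primesLE p.2)]

theorem tendsto_sum_primesLE {f : Nat.Primes → ℂ} {S : ℂ} (h : HasSum f S) :
    Tendsto (fun N => ∑ p ∈ (Nat.primesLE N).attach, f ⟨p, Nat.prime_of_mem_primesLE p.2⟩)
      atTop (𝓝 S) := by
  have h2 : HasSum (fun n : ℕ => if h : n.Prime then f ⟨n, h⟩ else 0) S := by
    rw [← hasSum_subtype_iff_of_support_subset (s := {n | n.Prime})]
    · refine h.congr_fun fun p => ?_
      exact dif_pos p.2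
    · intro n hn
      by_contra hc
      exact hn (dif_neg hc)
  simp_rw [sum_primesLE_attach]
  exact h2.tendsto_sum_nat.comp (tendsto_add_atTop_nat 1)

/-- Passing from the series over primes to the series over all natural numbers. -/
theorem tendsto_ldPartial (hx : ∀ p, ‖x p‖ = 1) {L : ℂ}
    (h : Tendsto (primePartial x) atTop (𝓝 L)) : Tendsto (ldPartial x) atTop (𝓝 (-L)) := by
  have h1 := (summable_ldTerm_nonprime hx).hasSum.tendsto_sum_nat.comp (tendsto_add_atTop_nat 1)
  have h2 := tendsto_sum_primesLE (hasSum_primePowerTail hx)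
  -- The limits of `h1` and `h2` are the same number: non-prime terms by size of `n`, and the same
  -- terms grouped by prime.
  have h3 := ((h.add h1).sub h2).neg
  rw [add_sub_cancel_right] at h3
  refine h3.congr fun N => ?_
  have hld : ldPartial x N = -∑ n ∈ Finset.range (N + 1), ldTerm x n := by
    have h0 : ldTerm x 0 = 0 := by simp [ldTerm]
    rw [Finset.range_eq_Ico, Finset.sum_eq_sum_Ico_succ_bot N.succ_pos, h0, zero_add]
    rfl
  rw [hld, neg_inj, Function.comp_apply, primePartial,
    sum_primesLE_attach (fun p => (Real.log (p : ℕ) : ℂ) * x p / (((p : ℕ) : ℂ) - x p)),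
    sum_primesLE_attach, ← Finset.sum_add_distrib, ← Finset.sum_sub_distrib]
  refine Finset.sum_congr rfl fun n _ => ?_
  by_cases hn : n.Prime
  · have hp0 : (n : ℂ) ≠ 0 := by exact_mod_cast hn.ne_zero
    have hpx := sub_ne_zero_of_norm_le_one hn.two_le (hx ⟨n, hn⟩).le
    have h4 := ldTerm_prime_pow (x := x) ⟨n, hn⟩ 0
    simp only [zero_add, pow_one] at h4
    simp only [hn, dite_true, if_true, h4, primePowerTail]
    have h5 : 1 - x ⟨n, hn⟩ / (n : ℂ) = ((n : ℂ) - x ⟨n, hn⟩) / n := by field_simp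
    rw [h5]
    field_simp
    ring
  · simp [hn]

end Rearrangement

/-! ### Supply of primes and decay estimates -/

section Decay

open Asymptotics

/-- The Chebyshev main terms are 4y log 2 from below at 4y and y log 4 from above at y. The ratio 4
leaves 2y log 2 > y, with room for the errors. -/
theorem eventually_le_sum_log_primes :
    ∀ᶠ y : ℕ in atTop, (y : ℝ) ≤ ∑ p ∈ Nat.primesLE (4 * y) \ Nat.primesLE y, Real.log p := by
  have hlog : ∀ᶠ u : ℝ in atTop, Real.log u ≤ 1 / 64 * u ^ (1 / 2 : ℝ) := by
    filter_upwards [(isLittleO_log_rpow_atTop (r := 1 / 2) (by norm_num)).bound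
      (show (0 : ℝ) < 1 / 64 by norm_num), eventually_ge_atTop 1] with u hu hu1
    rw [Real.norm_of_nonneg (Real.log_nonneg hu1), Real.norm_of_nonneg (by positivity)] at hu
    exact hu
  have ht : Tendsto (fun y : ℕ => (4 * y : ℝ)) atTop atTop :=
    tendsto_natCast_atTop_atTop.const_mul_atTop (by norm_num)
  filter_upwards [ht.eventually hlog, (tendsto_atTop_add_const_right _ (1 : ℝ) ht).eventually hlog,
    eventually_ge_atTop 1] with y h1 h2 hy
  have hy' : (1 : ℝ) ≤ y := by exact_mod_cast hy
  have hge := Chebyshev.theta_ge (4 * y)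
  have hle := Chebyshev.theta_le_log4_mul_x (x := (y : ℝ)) (by positivity)
  have hsub : Nat.primesLE y ⊆ Nat.primesLE (4 * y) := Nat.primesLE_mono (by omega)
  rw [Finset.sum_sdiff_eq_sub hsub, ← Chebyshev.theta_eq_sum_primesLE_log,
    ← Chebyshev.theta_eq_sum_primesLE_log]
  push_cast at hge ⊢
  rw [← Real.sqrt_eq_rpow] at h1 h2
  set s := √(4 * (y : ℝ)) with hs
  have hss : s * s = 4 * y := Real.mul_self_sqrt (by positivity)
  have hs0 : 0 ≤ s := Real.sqrt_nonneg _
  have hs2 : √(4 * (y : ℝ) + 1) ≤ 4 * y + 1 := by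
    rw [Real.sqrt_le_left (by positivity)]; nlinarith
  have hl4 : Real.log 4 = 2 * Real.log 2 := by
    rw [show (4 : ℝ) = 2 ^ 2 by norm_num, Real.log_pow]; norm_num
  have hl2 := Real.log_two_gt_d9
  have h3 : 2 * s * Real.log (4 * y) ≤ 2 * s * (1 / 64 * s) :=
    mul_le_mul_of_nonneg_left h1 (by positivity)
  rw [hl4] at hle
  have h4 := mul_le_mul_of_nonneg_right hl2.le (show (0 : ℝ) ≤ y by positivity)
  linarith

/-- Take the primes in (n³, 4n³] with n = ⌈√w⌉. Since log p ≤ n/8, each w log p / (p - 1) is at most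
n²(n/8)/n³ = 1/8. The sum of squares over 32 is at least w²/(512 n⁶) times the sum of log p, hence
at least w²/(512 n³), and n ≤ 2√w gives the constant 4096. -/
theorem exists_primes_sum_sq_ge (M : ℕ) : ∃ W : ℝ, ∀ w : ℝ, W ≤ w → ∃ F : Finset ℕ,
    (∀ p ∈ F, p.Prime ∧ M < p ∧ 3 ≤ p ∧ w * (Real.log p / (p - 1)) ≤ 1 / 8) ∧
    √w / 4096 ≤ ∑ p ∈ F, (w * (Real.log p / (p - 1))) ^ 2 / 32 := by
  have hcube : Tendsto (fun n : ℕ => n ^ 3) atTop atTop := tendsto_pow_atTop (by norm_num)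
  have hlog : ∀ᶠ n : ℕ in atTop, Real.log (4 * (n : ℝ) ^ 3) ≤ 1 / 8 * n := by
    have h1 : ∀ᶠ u : ℝ in atTop, Real.log u ≤ 1 / 48 * u := by
      filter_upwards [Real.isLittleO_log_id_atTop.bound (show (0 : ℝ) < 1 / 48 by norm_num),
        eventually_ge_atTop 1] with u hu hu1
      rwa [Real.norm_of_nonneg (Real.log_nonneg hu1), id, Real.norm_of_nonneg (by positivity)] at hu
    filter_upwards [tendsto_natCast_atTop_atTop.eventually h1, eventually_ge_atTop 24] with n hn hn1
    have hn1' : (24 : ℝ) ≤ n := by exact_mod_cast hn1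
    have : Real.log 4 ≤ 3 / 2 := by
      rw [show (4 : ℝ) = 2 ^ 2 by norm_num, Real.log_pow]
      have := Real.log_two_lt_d9
      push_cast; linarith
    rw [Real.log_mul (by norm_num) (by positivity), Real.log_pow]
    push_cast
    linarith
  obtain ⟨n₀, hn₀⟩ := eventually_atTop.1 ((hcube.eventually eventually_le_sum_log_primes).and hlog)
  -- Forces n ≥ n₀ + M + 3, so the asymptotic bounds apply and the chosen primes exceed both `M` and
  -- 3.
  refine ⟨((n₀ + M + 3 : ℕ) : ℝ) ^ 2, fun w hw => ?_⟩
  have hw0 : 0 ≤ w := le_trans (by positivity) hw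
  set t := √w with ht
  have htt : t ^ 2 = w := Real.sq_sqrt hw0
  have ht0 : ((n₀ + M + 3 : ℕ) : ℝ) ≤ t := Real.le_sqrt_of_sq_le hw
  set n := ⌈t⌉₊ with hn
  have htn : t ≤ n := Nat.le_ceil t
  have hnt : (n : ℝ) ≤ t + 1 := (Nat.ceil_lt_add_one (Real.sqrt_nonneg _)).le
  have hnn : n₀ + M + 3 ≤ n := by exact_mod_cast ht0.trans htn
  have ht3 : (3 : ℝ) ≤ t := le_trans (by push_cast; linarith [(n₀.cast_nonneg : (0:ℝ) ≤ n₀),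
    (M.cast_nonneg : (0:ℝ) ≤ M)]) ht0
  have hn3 : (3 : ℝ) ≤ n := ht3.trans htn
  obtain ⟨hsum, hl⟩ := hn₀ n (by omega)
  have hnpow : n ≤ n ^ 3 := Nat.le_self_pow (by norm_num) n
  have hcubepos : (0 : ℝ) < (n : ℝ) ^ 3 := by positivity
  have hmem : ∀ p ∈ Nat.primesLE (4 * n ^ 3) \ Nat.primesLE (n ^ 3),
      p.Prime ∧ n ^ 3 < p ∧ p ≤ 4 * n ^ 3 := by
    intro p hp
    rw [Finset.mem_sdiff, Nat.mem_primesLE, Nat.mem_primesLE] at hp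
    refine ⟨hp.1.2, ?_, hp.1.1⟩
    by_contra hc
    exact hp.2 ⟨not_lt.1 hc, hp.1.2⟩
  refine ⟨Nat.primesLE (4 * n ^ 3) \ Nat.primesLE (n ^ 3), fun p hp => ?_, ?_⟩
  · obtain ⟨h1, h2, h3⟩ := hmem p hp
    refine ⟨h1, by omega, by omega, ?_⟩
    have h2' : (n : ℝ) ^ 3 ≤ p - 1 := by
      have : ((n ^ 3 + 1 : ℕ) : ℝ) ≤ p := by exact_mod_cast h2
      push_cast at this
      linarith
    have h3' : (p : ℝ) ≤ 4 * (n : ℝ) ^ 3 := by exact_mod_cast h3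
    have hlp : Real.log p ≤ 1 / 8 * n :=
      (Real.log_le_log (by exact_mod_cast h1.pos) h3').trans hl
    have hq : Real.log p / (p - 1) ≤ 1 / 8 * n / (n : ℝ) ^ 3 :=
      div_le_div₀ (by positivity) hlp hcubepos h2'
    calc w * (Real.log p / (p - 1)) ≤ (n : ℝ) ^ 2 * (1 / 8 * n / (n : ℝ) ^ 3) := by
          refine mul_le_mul ?_ hq (div_nonneg (Real.log_natCast_nonneg p) (by linarith))
            (by positivity)
          rw [← htt]
          exact pow_le_pow_left₀ (by linarith) htn 2
      _ = 1 / 8 := by field_simp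
  · have hterm : ∀ p ∈ Nat.primesLE (4 * n ^ 3) \ Nat.primesLE (n ^ 3),
        w ^ 2 / (512 * (n : ℝ) ^ 6) * Real.log p ≤ (w * (Real.log p / (p - 1))) ^ 2 / 32 := by
      intro p hp
      obtain ⟨h1, h2, h3⟩ := hmem p hp
      have h3' : (p : ℝ) ≤ 4 * (n : ℝ) ^ 3 := by exact_mod_cast h3
      have hp3 : (3 : ℝ) ≤ p := by exact_mod_cast (show 3 ≤ p by omega)
      have hlp : 1 ≤ Real.log p := by
        rw [Real.le_log_iff_exp_le (by linarith)]
        have := Real.exp_one_lt_d9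
        linarith
      have hd : Real.log p / (4 * (n : ℝ) ^ 3) ≤ Real.log p / (p - 1) :=
        div_le_div_of_nonneg_left (by linarith) (by linarith) (by linarith)
      have hd2 : (Real.log p / (4 * (n : ℝ) ^ 3)) ^ 2 ≤ (Real.log p / (p - 1)) ^ 2 :=
        pow_le_pow_left₀ (by positivity) hd 2
      calc w ^ 2 / (512 * (n : ℝ) ^ 6) * Real.log p
          ≤ w ^ 2 / (512 * (n : ℝ) ^ 6) * Real.log p ^ 2 := by
            refine mul_le_mul_of_nonneg_left ?_ (by positivity)
            nlinarith
        _ = w ^ 2 * (Real.log p / (4 * (n : ℝ) ^ 3)) ^ 2 / 32 := by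
            field_simp
            ring
        _ ≤ w ^ 2 * (Real.log p / (p - 1)) ^ 2 / 32 := by gcongr
        _ = _ := by rw [mul_pow]
    refine le_trans ?_ (Finset.sum_le_sum hterm)
    rw [← Finset.mul_sum]
    push_cast at hsum
    refine le_trans ?_ (mul_le_mul_of_nonneg_left hsum (by positivity))
    have hn2 : (n : ℝ) ≤ 2 * t := by linarith
    have hn8 : (n : ℝ) ^ 3 ≤ 8 * t ^ 3 := by
      calc (n : ℝ) ^ 3 ≤ (2 * t) ^ 3 := pow_le_pow_left₀ (by positivity) hn2 3
        _ = _ := by ring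
    have : w ^ 2 / (512 * (n : ℝ) ^ 6) * (n : ℝ) ^ 3 = t ^ 4 / (512 * (n : ℝ) ^ 3) := by
      rw [← htt]; field_simp
    rw [this, div_le_div_iff₀ (by norm_num) (by positivity)]
    have h5 := mul_le_mul_of_nonneg_left hn8 (show 0 ≤ 512 * t by positivity)
    nlinarith

theorem exists_mul_exp_sqrt_ge {c : ℝ} (hc : 0 < c) (N : ℕ) :
    ∃ K, ∀ r : ℝ, 0 ≤ r → (1 + r) ^ N ≤ K * Real.exp (c * √r) := by
  refine ⟨2 ^ N * (1 + ((2 * N).factorial : ℝ) / c ^ (2 * N)), fun r hr => ?_⟩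
  have hpow : r ^ N ≤ ((2 * N).factorial : ℝ) / c ^ (2 * N) * Real.exp (c * √r) := by
    -- The exponent 2N turns powers of √r into powers of r.
    have h := Real.pow_div_factorial_le_exp (c * √r) (by positivity) (2 * N)
    rw [mul_pow, pow_mul (√r), Real.sq_sqrt hr, div_le_iff₀ (by positivity)] at h
    rw [div_mul_eq_mul_div, le_div_iff₀ (by positivity)]
    linarith
  have h1 : 1 ≤ Real.exp (c * √r) := Real.one_le_exp (by positivity)
  have h2 : (1 + r) ^ N ≤ 2 ^ N * (1 + r ^ N) := by
    rcases le_total r 1 with h | h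
    · calc (1 + r) ^ N ≤ 2 ^ N := pow_le_pow_left₀ (by linarith) (by linarith) N
        _ ≤ 2 ^ N * (1 + r ^ N) := le_mul_of_one_le_right (by positivity)
            (by linarith [pow_nonneg hr N])
    · calc (1 + r) ^ N ≤ (2 * r) ^ N := pow_le_pow_left₀ (by linarith) (by linarith) N
        _ = 2 ^ N * r ^ N := mul_pow _ _ _
        _ ≤ 2 ^ N * (1 + r ^ N) := by gcongr; linarith
  refine h2.trans ?_
  rw [mul_assoc]
  gcongr
  linarith

/-- Functions decaying like `exp (-c √‖w‖)` have all moments. -/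
theorem integrable_pow_mul_of_le_exp_sqrt {f : ℂ → ℂ} (hf : Continuous f) {c C : ℝ} (hc : 0 < c)
    (hC : ∀ w, ‖f w‖ ≤ C * Real.exp (-(c * √‖w‖))) (n : ℕ) :
    Integrable fun w : ℂ => ‖w‖ ^ n * ‖f w‖ := by
  -- The three extra powers exceed the real dimension 2, leaving an integrable majorant.
  obtain ⟨K, hK⟩ := exists_mul_exp_sqrt_ge hc (n + 3)
  have hint : Integrable fun w : ℂ => (1 + ‖w‖) ^ (-3 : ℝ) :=
    integrable_one_add_norm (by rw [Complex.finrank_real_complex]; norm_num)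
  refine (hint.const_mul (C * K)).mono' (by fun_prop) (ae_of_all _ fun w => ?_)
  have hw := norm_nonneg w
  have hC0 : 0 ≤ C := by
    have := (norm_nonneg _).trans (hC 0)
    simpa using this
  rw [Real.norm_of_nonneg (by positivity), Real.rpow_neg (by positivity),
    show (3 : ℝ) = (3 : ℕ) by norm_num, Real.rpow_natCast]
  have h1 := hK ‖w‖ hw
  have hkey : ‖w‖ ^ n * Real.exp (-(c * √‖w‖)) * (1 + ‖w‖) ^ 3 ≤ K := by
    calc ‖w‖ ^ n * Real.exp (-(c * √‖w‖)) * (1 + ‖w‖) ^ 3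
        ≤ (1 + ‖w‖) ^ n * Real.exp (-(c * √‖w‖)) * (1 + ‖w‖) ^ 3 := by gcongr; linarith
      _ = (1 + ‖w‖) ^ (n + 3) * Real.exp (-(c * √‖w‖)) := by ring
      _ ≤ K * Real.exp (c * √‖w‖) * Real.exp (-(c * √‖w‖)) := by gcongr
      _ = K := by rw [mul_assoc, ← Real.exp_add]; simp
  calc ‖w‖ ^ n * ‖f w‖ ≤ ‖w‖ ^ n * (C * Real.exp (-(c * √‖w‖))) := by gcongr; exact hC w
    _ = C * (‖w‖ ^ n * Real.exp (-(c * √‖w‖))) := by ring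
    _ ≤ C * (K * ((1 + ‖w‖) ^ 3)⁻¹) := by
        refine mul_le_mul_of_nonneg_left ?_ hC0
        rwa [← div_eq_mul_inv, le_div_iff₀ (by positivity)]
    _ = _ := by ring

end Decay

/-! ### Sums of circles -/

section CircleSums

theorem exists_unit_mul_norm_eq (t : ℂ) : ∃ d : ℂ, ‖d‖ = 1 ∧ t = ‖t‖ * d := by
  by_cases ht : t = 0
  · exact ⟨1, norm_one, by simp [ht]⟩
  · have h : ‖t‖ ≠ 0 := norm_ne_zero_iff.2 ht
    have h' : (‖t‖ : ℂ) ≠ 0 := by exact_mod_cast h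
    refine ⟨t / ‖t‖, ?_, by field_simp⟩
    rw [norm_div, Complex.norm_real, norm_norm, div_self h]

theorem norm_sub_mul_of_direction {t d : ℂ} (hd : ‖d‖ = 1) (ht : t = ‖t‖ * d) (a : ℝ) :
    ‖t - a * d‖ = |‖t‖ - a| := by
  have : t - a * d = ((‖t‖ - a : ℝ) : ℂ) * d := by
    nth_rewrite 1 [ht]
    push_cast
    ring
  rw [this, norm_mul, hd, mul_one, Complex.norm_real, Real.norm_eq_abs]

/-- The sum of two circles around the origin contains an annulus. -/
theorem exists_two_units {a b : ℝ} (ha : 0 ≤ a) (hb : 0 < b) {t : ℂ} (h1 : |a - b| ≤ ‖t‖)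
    (h2 : ‖t‖ ≤ a + b) : ∃ u v : ℂ, ‖u‖ = 1 ∧ ‖v‖ = 1 ∧ a * u + b * v = t := by
  obtain ⟨d, hd, htd⟩ := exists_unit_mul_norm_eq t
  -- The distance from `t` to a point moving on the circle of radius `a`, from the direction of `t`
  -- to the opposite one; it takes the value `b` on the way.
  let g : ℝ → ℝ := fun θ => ‖t - a * (d * Complex.exp (θ * Complex.I))‖
  have hg : ContinuousOn g (Set.Icc 0 Real.pi) := by
    refine Continuous.continuousOn ?_
    fun_prop
  have h0 : g 0 ≤ b := by
    simp only [g, Complex.ofReal_zero, zero_mul, Complex.exp_zero, mul_one]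
    rw [norm_sub_mul_of_direction hd htd, abs_le]
    constructor <;> linarith [(abs_le.1 h1).1, (abs_le.1 h1).2]
  have hpi : b ≤ g Real.pi := by
    have := norm_sub_mul_of_direction hd htd (-a)
    simp only [g, Complex.exp_pi_mul_I]
    rw [show t - a * (d * -1) = t - ((-a : ℝ) : ℂ) * d by push_cast; ring, this,
      abs_of_nonneg (by linarith [norm_nonneg t])]
    linarith [(abs_le.1 h1).1, (abs_le.1 h1).2]
  obtain ⟨θ, -, hθ⟩ := intermediate_value_Icc Real.pi_pos.le hg ⟨h0, hpi⟩
  have hb' : (b : ℂ) ≠ 0 := by exact_mod_cast hb.ne'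
  refine ⟨d * Complex.exp (θ * Complex.I), (t - a * (d * Complex.exp (θ * Complex.I))) / b,
    ?_, ?_, by field_simp; ring⟩
  · rw [norm_mul, hd, Complex.norm_exp_ofReal_mul_I, one_mul]
  · rw [norm_div, Complex.norm_real, Real.norm_of_nonneg hb.le, div_eq_one_iff_eq hb.ne']
    exact hθ

/-- Sums of circles around the origin whose radii satisfy polygon inequalities contain discs. -/
theorem exists_units_sum_eq {r : ℕ → ℝ} (hr : ∀ k, 0 < r k) (h10 : r 1 ≤ r 0) (h21 : r 2 ≤ r 1)
    (h012 : r 0 ≤ r 1 + r 2) (hstep : ∀ k, 3 ≤ k → r k ≤ ∑ i ∈ Finset.range k, r i) {n : ℕ}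
    (hn : 3 ≤ n) : ∀ t : ℂ, ‖t‖ ≤ ∑ i ∈ Finset.range n, r i →
      ∃ u : ℕ → ℂ, (∀ i, ‖u i‖ = 1) ∧ ∑ i ∈ Finset.range n, (r i : ℂ) * u i = t := by
  induction n, hn using Nat.le_induction with
  | base =>
    intro t ht
    obtain ⟨d, hd, htd⟩ := exists_unit_mul_norm_eq t
    simp only [Finset.sum_range_succ, Finset.sum_range_zero, zero_add] at ht
    -- Remove the third vector along `t`; if that lands inside the hole of the annulus, remove it in
    -- the opposite direction.
    have hex : ∃ e : ℂ, ‖e‖ = 1 ∧ |r 0 - r 1| ≤ ‖t - r 2 * e‖ ∧ ‖t - r 2 * e‖ ≤ r 0 + r 1 := by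
      rw [abs_of_nonneg (by linarith)]
      by_cases hc : r 0 - r 1 ≤ |‖t‖ - r 2|
      · refine ⟨d, hd, ?_⟩
        rw [norm_sub_mul_of_direction hd htd]
        exact ⟨hc, abs_le.2 ⟨by linarith [norm_nonneg t, hr 0, hr 1], by linarith⟩⟩
      · refine ⟨-d, by rwa [norm_neg], ?_⟩
        have := norm_sub_mul_of_direction hd htd (-r 2)
        rw [show t - r 2 * -d = t - ((-r 2 : ℝ) : ℂ) * d by push_cast; ring, this,
          abs_of_nonneg (by linarith [norm_nonneg t, hr 2])]
        have := (abs_lt.1 (not_le.1 hc)).2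
        exact ⟨by linarith [norm_nonneg t], by linarith⟩
    obtain ⟨e, he, he1, he2⟩ := hex
    obtain ⟨u, v, hu, hv, huv⟩ := exists_two_units (hr 0).le (hr 1) he1 he2
    refine ⟨fun i => if i = 0 then u else if i = 1 then v else e, fun i => ?_, ?_⟩
    · dsimp only
      split_ifs <;> assumption
    · simp only [Finset.sum_range_succ, Finset.sum_range_zero]
      simp only [zero_add, if_true, one_ne_zero, if_false, OfNat.ofNat_ne_zero,
        OfNat.ofNat_ne_one, huv]
      ring
  | succ n hn ih =>
    intro t ht
    obtain ⟨d, hd, htd⟩ := exists_unit_mul_norm_eq t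
    rw [Finset.sum_range_succ] at ht
    obtain ⟨u, hu, hsum⟩ := ih (t - r n * d) (by
      rw [norm_sub_mul_of_direction hd htd, abs_le]
      exact ⟨by linarith [norm_nonneg t, hstep n hn], by linarith⟩)
    refine ⟨fun i => if i = n then d else u i, fun i => ?_, ?_⟩
    · dsimp only
      split_ifs
      exacts [hd, hu i]
    · have hcongr : ∑ i ∈ Finset.range n, (r i : ℂ) * (if i = n then d else u i) =
          ∑ i ∈ Finset.range n, (r i : ℂ) * u i :=
        Finset.sum_congr rfl fun i hi => by rw [if_neg (Finset.mem_range.1 hi).ne]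
      simp only [Finset.sum_range_succ, if_true, hcongr, hsum]
      ring

/-- The image of the unit circle under `primeTerm p` is a circle. -/
theorem exists_primeTerm_eq {p : ℕ} (hp : 2 ≤ p) {u : ℂ} (hu : ‖u‖ = 1) :
    ∃ z : ℂ, ‖z‖ = 1 ∧ primeTerm p z =
      ((p * Real.log p / (p ^ 2 - 1) : ℝ) : ℂ) * u - ((Real.log p / (p ^ 2 - 1) : ℝ) : ℂ) := by
  have hpu := sub_ne_zero_of_norm_le_one hp hu.le
  have hp' : (2 : ℝ) ≤ p := by exact_mod_cast hp
  have hq : ((p : ℂ) ^ 2 - 1) ≠ 0 := by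
    have : ((p : ℝ) ^ 2 - 1) ≠ 0 := by nlinarith
    exact_mod_cast this
  have hnorm : ‖1 - p * u‖ = ‖(p : ℂ) - u‖ := by
    have h1 : (1 : ℂ) - p * u = u * (starRingEnd ℂ) (u - p) := by
      have : u * (starRingEnd ℂ) u = 1 := by rw [Complex.mul_conj']; simp [hu]
      rw [map_sub, mul_sub, this, Complex.conj_natCast]
      ring
    rw [h1, norm_mul, hu, one_mul, RCLike.norm_conj, norm_sub_rev]
  have hz : ‖(1 - p * u) / (p - u)‖ = 1 := by
    rw [norm_div, hnorm, div_self (norm_ne_zero_iff.2 hpu)]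
  -- This Möbius map is an involution preserving the unit circle, and it turns `primeTerm p` into an
  -- affine map.
  refine ⟨(1 - p * u) / (p - u), hz, ?_⟩
  rw [primeTerm]
  push_cast
  have h2 : (p : ℂ) - (1 - p * u) / (p - u) = (p ^ 2 - 1) / (p - u) := by
    field_simp
    ring
  rw [h2]
  field_simp
  ring

end CircleSums

/-! ### Primes in increasing order and filling of discs -/

section Enumeration

/-- The increasing enumeration of the primes. -/
noncomputable def nthPrime (k : ℕ) : ℕ := Nat.nth Nat.Prime k

theorem prime_nthPrime (k : ℕ) : (nthPrime k).Prime := Nat.prime_nth_prime k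

/-- The increasing enumeration of the primes, as an equivalence. -/
noncomputable def primesEquiv : ℕ ≃ Nat.Primes :=
  Equiv.ofBijective (fun k => ⟨nthPrime k, prime_nthPrime k⟩)
    ⟨fun _ _ h => Nat.nth_injective Nat.infinite_setOfPred_prime (congrArg Subtype.val h),
      fun p => ⟨Nat.count Nat.Prime p, Subtype.ext (Nat.nth_count p.2)⟩⟩

theorem coe_primesEquiv (k : ℕ) : (primesEquiv k : ℕ) = nthPrime k := rfl

theorem add_two_le_nthPrime (k : ℕ) : k + 2 ≤ nthPrime k := Nat.add_two_le_nth_prime k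

/-- From log p ≤ 4 p^(1/4) and p - 1 ≥ p/2. The square of the bound has exponent -3/2, which is
summable. -/
theorem log_div_sub_one_le {p : ℕ} (hp : 2 ≤ p) :
    Real.log p / (p - 1) ≤ 8 * (p : ℝ) ^ (-(3 / 4) : ℝ) := by
  have hp' : (2 : ℝ) ≤ p := by exact_mod_cast hp
  have h1 : Real.log p ≤ (p : ℝ) ^ (1 / 4 : ℝ) / (1 / 4) :=
    Real.log_le_rpow_div (by positivity) (by norm_num)
  rw [div_le_iff₀ (by linarith)]
  have h2 : (p : ℝ) ^ (-(3 / 4) : ℝ) * p = (p : ℝ) ^ (1 / 4 : ℝ) := by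
    rw [← Real.rpow_add_one (by positivity)]
    norm_num
  have h3 : 0 < (p : ℝ) ^ (-(3 / 4) : ℝ) := by positivity
  nlinarith

theorem summable_log_div_sub_one_sq :
    Summable fun k => (Real.log (nthPrime k) / (nthPrime k - 1)) ^ 2 := by
  have h : Summable fun k : ℕ => 64 * ((k : ℝ) ^ (3 / 2 : ℝ))⁻¹ :=
    (Real.summable_nat_rpow_inv.2 (by norm_num)).mul_left 64
  refine Summable.of_nonneg_of_le (fun k => sq_nonneg _) (fun k => ?_) ((summable_nat_add_iff 1).2 h)
  have hp := add_two_le_nthPrime k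
  have hp' : (k : ℝ) + 2 ≤ nthPrime k := by exact_mod_cast hp
  have hk : (0 : ℝ) ≤ k := k.cast_nonneg
  have h0 : 0 ≤ Real.log (nthPrime k) / (nthPrime k - 1) :=
    div_nonneg (Real.log_natCast_nonneg _) (by linarith)
  refine (pow_le_pow_left₀ h0 (log_div_sub_one_le (by omega)) 2).trans ?_
  rw [mul_pow, ← Real.rpow_natCast (_ ^ _), ← Real.rpow_mul (by positivity),
    ← Real.rpow_neg (by positivity)]
  norm_num
  exact Real.rpow_le_rpow_of_nonpos (by positivity) (by linarith) (by norm_num)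

/-- Makes the centres of the circles summable; the inequality amounts to (p - 1)/(p + 1) ≤ log p. -/
theorem log_div_sq_sub_one_le {p : ℕ} (hp : 2 ≤ p) :
    Real.log p / (p ^ 2 - 1) ≤ (Real.log p / (p - 1)) ^ 2 := by
  have hp' : (2 : ℝ) ≤ p := by exact_mod_cast hp
  have hl : 0 < Real.log p := Real.log_pos (by linarith)
  have h1 : 1 - (p : ℝ)⁻¹ ≤ Real.log p := Real.one_sub_inv_le_log_of_pos (by linarith)
  have h2 : ((p : ℝ) - 1) / (p + 1) ≤ Real.log p := by
    refine le_trans ?_ h1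
    rw [div_le_iff₀ (by linarith)]
    have : (p : ℝ)⁻¹ ≤ 1 := inv_le_one_of_one_le₀ (by linarith)
    have h3 : (p : ℝ)⁻¹ * p = 1 := inv_mul_cancel₀ (by positivity)
    nlinarith
  rw [div_le_iff₀ (by linarith)] at h2
  rw [div_pow, div_le_div_iff₀ (by nlinarith) (by nlinarith)]
  have h4 : 0 ≤ Real.log p * (p - 1) := mul_nonneg hl.le (by linarith)
  nlinarith [mul_le_mul_of_nonneg_left h2 h4]

/-- The radii dominate (log 2)/p, and the reciprocals of the primes have divergent sum. -/
theorem tendsto_sum_circle_radius :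
    Tendsto (fun n => ∑ k ∈ Finset.range n,
      (nthPrime k * Real.log (nthPrime k) / ((nthPrime k : ℝ) ^ 2 - 1))) atTop atTop := by
  have hp2 : ∀ k, (2 : ℝ) ≤ nthPrime k := fun k => by exact_mod_cast (prime_nthPrime k).two_le
  have hle : ∀ k, Real.log 2 * (1 / (nthPrime k : ℝ)) ≤
      nthPrime k * Real.log (nthPrime k) / ((nthPrime k : ℝ) ^ 2 - 1) := by
    intro k
    have h := hp2 k
    have hl := Real.log_le_log (by norm_num) h
    have h2 : 0 < Real.log 2 := Real.log_pos (by norm_num)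
    rw [mul_one_div, div_le_div_iff₀ (by linarith) (by nlinarith)]
    nlinarith [mul_le_mul_of_nonneg_right hl (sq_nonneg (nthPrime k : ℝ))]
  refine not_summable_iff_tendsto_nat_atTop_of_nonneg (fun k => ?_) |>.1 fun hs => ?_
  · refine div_nonneg (mul_nonneg (by positivity) (Real.log_natCast_nonneg _)) ?_
    nlinarith [hp2 k]
  · have h1 : Summable fun k => Real.log 2 * (1 / (nthPrime k : ℝ)) :=
      Summable.of_nonneg_of_le (fun k => mul_nonneg (Real.log_nonneg (by norm_num))
        (by positivity)) hle hs
    rw [summable_mul_left_iff (Real.log_pos (by norm_num)).ne'] at h1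
    exact Nat.Primes.not_summable_one_div (primesEquiv.summable_iff.1 h1)

theorem nthPrime_zero : nthPrime 0 = 2 := Nat.nth_prime_zero_eq_two
theorem nthPrime_one : nthPrime 1 = 3 := Nat.nth_prime_one_eq_three
theorem nthPrime_two : nthPrime 2 = 5 := Nat.nth_prime_two_eq_five

/-- Finite sums of the terms of `Ld(1, x)` fill arbitrarily large discs. -/
theorem exists_sum_primeTerm_eq (R : ℝ) : ∃ N₀, ∀ N, N₀ ≤ N → ∀ t : ℂ, ‖t‖ ≤ R →
    ∃ x : ℕ → ℂ, (∀ k, ‖x k‖ = 1) ∧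
      ∑ k ∈ Finset.range N, primeTerm (nthPrime k) (x k) = t := by
  let r : ℕ → ℝ := fun k => nthPrime k * Real.log (nthPrime k) / ((nthPrime k : ℝ) ^ 2 - 1)
  let c : ℕ → ℝ := fun k => Real.log (nthPrime k) / ((nthPrime k : ℝ) ^ 2 - 1)
  have hp2 : ∀ k, (2 : ℝ) ≤ nthPrime k := fun k => by exact_mod_cast (prime_nthPrime k).two_le
  have hc0 : ∀ k, 0 ≤ c k := fun k =>
    div_nonneg (Real.log_natCast_nonneg _) (by nlinarith [hp2 k])
  have hr : ∀ k, 0 < r k := fun k =>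
    div_pos (mul_pos (by linarith [hp2 k]) (Real.log_pos (by linarith [hp2 k])))
      (by nlinarith [hp2 k])
  have hr1 : ∀ k, r k ≤ 1 := by
    intro k
    have h := hp2 k
    have hl := Real.log_le_sub_one_of_pos (show (0 : ℝ) < nthPrime k by linarith)
    rw [div_le_one (by nlinarith)]
    nlinarith
  have e0 : r 0 = 2 * Real.log 2 / 3 := by
    simp only [r, nthPrime_zero]; norm_num
  have e1 : r 1 = 3 * Real.log 3 / 8 := by
    simp only [r, nthPrime_one]; norm_num
  have e2 : r 2 = 5 * Real.log 5 / 24 := by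
    simp only [r, nthPrime_two]; norm_num
  have hlog : ∀ (a b : ℕ) (m n : ℕ), 0 < a → (a : ℝ) ^ m ≤ (b : ℝ) ^ n →
      m * Real.log a ≤ n * Real.log b := by
    intro a b m n ha h
    rw [← Real.log_pow, ← Real.log_pow]
    exact Real.log_le_log (by positivity) h
  -- The first three radii times 24 are 16 log 2, 9 log 3 and 5 log 5; these comparisons order them,
  -- give the triangle inequality and show that their sum is at least 1.
  have l53 := hlog 5 3 5 9 (by norm_num) (by norm_num)
  have l32 := hlog 3 2 9 16 (by norm_num) (by norm_num)
  have l23 := hlog 2 3 3 2 (by norm_num) (by norm_num)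
  have l25 := hlog 2 5 9 4 (by norm_num) (by norm_num)
  have l2 := Real.log_two_gt_d9
  push_cast at l53 l32 l23 l25
  -- Every radius is at most 1, which the first three already exceed together.
  have hstep : ∀ k, 3 ≤ k → r k ≤ ∑ i ∈ Finset.range k, r i := by
    intro k hk
    refine (hr1 k).trans ?_
    have h3 : ∑ i ∈ Finset.range 3, r i ≤ ∑ i ∈ Finset.range k, r i :=
      Finset.sum_le_sum_of_subset_of_nonneg (Finset.range_mono hk) fun i _ _ => (hr i).le
    refine le_trans ?_ h3
    simp only [Finset.sum_range_succ, Finset.sum_range_zero, e0, e1, e2]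
    linarith
  have hc : Summable c := Summable.of_nonneg_of_le hc0
    (fun k => log_div_sq_sub_one_le (prime_nthPrime k).two_le) summable_log_div_sub_one_sq
  obtain ⟨N₀, hN₀⟩ := eventually_atTop.1
    (tendsto_sum_circle_radius.eventually_ge_atTop (R + ∑' k, c k))
  refine ⟨max N₀ 3, fun N hN t ht => ?_⟩
  -- The target is shifted by the bounded sum of the centres, reducing to circles about the origin.
  have hbound : ‖t + ((∑ k ∈ Finset.range N, c k : ℝ) : ℂ)‖ ≤ ∑ i ∈ Finset.range N, r i := by
    refine (norm_add_le _ _).trans (le_trans ?_ (hN₀ N (le_of_max_le_left hN)))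
    rw [Complex.norm_real, Real.norm_of_nonneg (Finset.sum_nonneg fun k _ => hc0 k)]
    exact add_le_add ht (hc.sum_le_tsum _ fun k _ => hc0 k)
  obtain ⟨u, hu, hsum⟩ := exists_units_sum_eq hr (by rw [e0, e1]; linarith)
    (by rw [e1, e2]; linarith) (by rw [e0, e1, e2]; linarith) hstep (le_of_max_le_right hN) _ hbound
  choose x hx hxu using fun k => exists_primeTerm_eq (prime_nthPrime k).two_le (hu k)
  refine ⟨x, hx, ?_⟩
  simp_rw [hxu]
  rw [Finset.sum_sub_distrib, hsum]
  push_cast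
  simp [c]

end Enumeration

/-! ### The random sum, its tails and their characteristic functions -/

section RandomEulerSum

variable {Ω : Type*} [MeasurableSpace Ω] {P : Measure Ω} {X : Nat.Primes → Ω → ℂ}

/-- The contribution of the `k`-th prime to `Ld(1, X)`. -/
noncomputable def randTerm (X : Nat.Primes → Ω → ℂ) (k : ℕ) (ω : Ω) : ℂ :=
  primeTerm (nthPrime k) (X (primesEquiv k) ω)

/-- The contribution to `Ld(1, X)` of all but the first `m` primes. -/
noncomputable def ldTail (X : Nat.Primes → Ω → ℂ) (m : ℕ) (ω : Ω) : ℂ :=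
  Ld X ω - ∑ k ∈ Finset.range m, randTerm X k ω

/-- The characteristic function of the contribution of the `k`-th prime. -/
noncomputable def termCharFun (k : ℕ) (w : ℂ) : ℂ :=
  charFun (uniformCircle.map (primeTerm (nthPrime k))) w

theorem measurable_randTerm (hmeas : ∀ p, Measurable (X p)) (k : ℕ) : Measurable (randTerm X k) :=
  (measurable_primeTerm _).comp (hmeas _)

theorem measurable_sum_randTerm (hmeas : ∀ p, Measurable (X p)) (s : Finset ℕ) :
    Measurable (∑ k ∈ s, randTerm X k) := by
  have : (∑ k ∈ s, randTerm X k) = fun ω => ∑ k ∈ s, randTerm X k ω :=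
    funext fun ω => Finset.sum_apply ω s _
  rw [this]
  exact Finset.measurable_fun_sum s fun k _ => measurable_randTerm hmeas k

theorem iIndepFun_randTerm (hindep : iIndepFun X P) : iIndepFun (randTerm X) P :=
  (hindep.precomp primesEquiv.injective).comp (fun k => primeTerm (nthPrime k))
    fun _ => measurable_primeTerm _

theorem map_randTerm (hmeas : ∀ p, Measurable (X p)) (hunif : ∀ p, P.map (X p) = uniformCircle)
    (k : ℕ) : P.map (randTerm X k) = uniformCircle.map (primeTerm (nthPrime k)) := by
  rw [← hunif (primesEquiv k), Measure.map_map (measurable_primeTerm _) (hmeas _)]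
  rfl

theorem ae_norm_eq_one (hmeas : ∀ p, Measurable (X p))
    (hunif : ∀ p, P.map (X p) = uniformCircle) : ∀ᵐ ω ∂P, ∀ p, ‖X p ω‖ = 1 := by
  rw [ae_all_iff]
  intro p
  have h := ae_norm_eq_one_uniformCircle
  rw [← hunif p] at h
  exact ae_of_ae_map (hmeas p).aemeasurable h

/-- Every neighbourhood of a possible value of a partial sum is reached with positive
probability. -/
theorem map_sum_randTerm_pos (hmeas : ∀ p, Measurable (X p)) (hindep : iIndepFun X P)
    (hunif : ∀ p, P.map (X p) = uniformCircle) {N : ℕ} {V : Set ℂ} (hV : IsOpen V) {x : ℕ → ℂ}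
    (hx : ∀ k, ‖x k‖ = 1)
    (hxV : ∑ k ∈ Finset.range N, primeTerm (nthPrime k) (x k) ∈ V) :
    0 < P.map (∑ k ∈ Finset.range N, randTerm X k) V := by
  have hcont : ContinuousAt
      (fun y : ℕ → ℂ => ∑ k ∈ Finset.range N, primeTerm (nthPrime k) (y k)) x := by
    refine tendsto_finsetSum _ fun k _ => ?_
    exact (differentiableAt_primeTerm (prime_nthPrime k).two_le (hx k).le).continuousAt.tendsto.comp
      (continuous_apply k).continuousAt
  have hnhds := hcont (hV.mem_nhds hxV)
  -- A neighbourhood in the product topology constrains finitely many coordinates, so independence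
  -- reduces the claim to open arcs of positive mass.
  rw [mem_map, nhds_pi, mem_pi'] at hnhds
  obtain ⟨I, t, ht, hsub⟩ := hnhds
  rw [Measure.map_apply (measurable_sum_randTerm hmeas _) hV.measurableSet]
  have hprod := (hindep.precomp primesEquiv.injective).measure_inter_preimage_eq_mul I
    (sets := fun k => interior (t k)) fun k _ => isOpen_interior.measurableSet
  refine lt_of_lt_of_le ?_ (measure_mono (s := ⋂ k ∈ I, X (primesEquiv k) ⁻¹' interior (t k)) ?_)
  · rw [hprod]
    refine CanonicallyOrderedAdd.prod_pos.2 fun k _ => ?_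
    rw [← Measure.map_apply (hmeas _) isOpen_interior.measurableSet, hunif]
    exact uniformCircle_pos_of_isOpen isOpen_interior (hx k) (mem_interior_iff_mem_nhds.2 (ht k))
  · intro ω hω
    have hmem : (fun k => X (primesEquiv k) ω) ∈ (I : Set ℕ).pi t := fun k hk =>
      interior_subset (Set.mem_iInter₂.1 hω k hk)
    have := hsub hmem
    simpa [randTerm, Finset.sum_apply] using this

theorem primePartial_eq_neg_sum (x : Nat.Primes → ℂ) (N : ℕ) :
    primePartial x N = -∑ k ∈ Finset.range (Nat.count Nat.Prime (N + 1)),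
      primeTerm (nthPrime k) (x (primesEquiv k)) := by
  rw [primePartial,
    sum_primesLE_attach fun p => (Real.log (p : ℕ) : ℂ) * x p / (((p : ℕ) : ℂ) - x p)]
  generalize N + 1 = M
  induction M with
  | zero => simp
  | succ M ih =>
    rw [Finset.sum_range_succ, ih, Nat.count_succ]
    by_cases hM : M.Prime
    · have he : primesEquiv (Nat.count Nat.Prime M) = ⟨M, hM⟩ := Subtype.ext (Nat.nth_count hM)
      rw [dif_pos hM, if_pos hM, Finset.sum_range_succ, he, ← coe_primesEquiv, he, neg_add,
        primeTerm, neg_neg]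
    · rw [dif_neg hM, if_neg hM, add_zero, add_zero]

theorem tendsto_count_prime : Tendsto (fun N => Nat.count Nat.Prime (N + 1)) atTop atTop :=
  Nat.tendsto_primeCounting'.comp (tendsto_add_atTop_nat 1)

variable [IsProbabilityMeasure P]

/-- The random series converges almost surely, over the integers and over the primes. -/
theorem ae_tendsto_Ld (hmeas : ∀ p, Measurable (X p)) (hindep : iIndepFun X P)
    (hunif : ∀ p, P.map (X p) = uniformCircle) :
    ∀ᵐ ω ∂P, Tendsto (fun n => ∑ k ∈ Finset.range n, randTerm X k ω) atTop (𝓝 (Ld X ω)) ∧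
      Tendsto (ldPartial (fun p => X p ω)) atTop (𝓝 (Ld X ω)) ∧
      Tendsto (primePartial (fun p => X p ω)) atTop (𝓝 (-Ld X ω)) := by
  have hone := ae_norm_eq_one hmeas hunif
  have hconv := ae_exists_tendsto_sum_of_iIndepFun_complex (P := P)
    (a := fun k => Real.log (nthPrime k) / (nthPrime k - 1)) (measurable_randTerm hmeas)
    (iIndepFun_randTerm hindep) (fun k => by
      have h1 := integral_map (μ := P) (hmeas (primesEquiv k)).aemeasurable
        (f := primeTerm (nthPrime k)) (measurable_primeTerm _).aestronglyMeasurable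
      have h2 := integral_primeTerm_pow (prime_nthPrime k).two_le one_ne_zero
      simp only [pow_one] at h2
      rw [hunif, h2] at h1
      exact h1.symm)
    (fun k => hone.mono fun ω hω => norm_primeTerm_le (prime_nthPrime k).two_le (hω _))
    summable_log_div_sub_one_sq
  filter_upwards [hone, hconv] with ω hω ⟨S, hS⟩
  have hprime : Tendsto (primePartial (fun p => X p ω)) atTop (𝓝 (-S)) := by
    refine (hS.comp tendsto_count_prime).neg.congr fun N => ?_
    rw [primePartial_eq_neg_sum]
    rfl
  have hld : Tendsto (ldPartial (fun p => X p ω)) atTop (𝓝 S) := by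
    simpa using tendsto_ldPartial hω hprime
  -- `Ld` is a `limUnder` along the integers, so it is identified only at points where that series
  -- converges.
  have hS' : Ld X ω = S := hld.limUnder_eq
  rw [hS']
  exact ⟨hS, hld, hprime⟩

theorem aemeasurable_Ld (hmeas : ∀ p, Measurable (X p)) (hindep : iIndepFun X P)
    (hunif : ∀ p, P.map (X p) = uniformCircle) : AEMeasurable (Ld X) P :=
  aemeasurable_of_tendsto_metrizable_ae atTop
    (fun n => (Finset.measurable_fun_sum (Finset.range n)
      fun k _ => measurable_randTerm hmeas k).aemeasurable)
    ((ae_tendsto_Ld hmeas hindep hunif).mono fun _ h => h.1)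

theorem aemeasurable_ldTail (hmeas : ∀ p, Measurable (X p)) (hindep : iIndepFun X P)
    (hunif : ∀ p, P.map (X p) = uniformCircle) (m : ℕ) : AEMeasurable (ldTail X m) P :=
  (aemeasurable_Ld hmeas hindep hunif).sub (Finset.measurable_fun_sum (Finset.range m)
    fun k _ => measurable_randTerm hmeas k).aemeasurable

theorem charFun_map_sum_randTerm (hmeas : ∀ p, Measurable (X p)) (hindep : iIndepFun X P)
    (hunif : ∀ p, P.map (X p) = uniformCircle) (s : Finset ℕ) (w : ℂ) :
    charFun (P.map (∑ k ∈ s, randTerm X k)) w = ∏ k ∈ s, termCharFun k w := by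
  have hm := measurable_randTerm hmeas
  induction s using Finset.induction_on with
  | empty =>
    have : P.map (∑ k ∈ ∅, randTerm X k) = Measure.dirac 0 := by
      rw [Finset.sum_empty]
      exact (Measure.map_const P (0 : ℂ)).trans (by simp)
    rw [this, charFun_dirac]
    simp
  | insert a s ha ih =>
    rw [Finset.sum_insert ha, Finset.prod_insert ha, add_comm,
      ((iIndepFun_randTerm hindep).indepFun_finsetSum_of_notMem hm ha).charFun_map_add_eq_mul
        (measurable_sum_randTerm hmeas s).aemeasurable (hm a).aemeasurable,
      Pi.mul_apply, ih, map_randTerm hmeas hunif, mul_comm]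
    rfl

theorem tendsto_prod_termCharFun (hmeas : ∀ p, Measurable (X p)) (hindep : iIndepFun X P)
    (hunif : ∀ p, P.map (X p) = uniformCircle) (m : ℕ) (w : ℂ) :
    Tendsto (fun n => ∏ k ∈ Finset.Ico m n, termCharFun k w) atTop
      (𝓝 (charFun (P.map (ldTail X m)) w)) := by
  rw [charFun_apply, integral_map (aemeasurable_ldTail hmeas hindep hunif m) (by fun_prop)]
  have heq : ∀ n, ∏ k ∈ Finset.Ico m n, termCharFun k w = ∫ ω, Complex.exp
      ((inner ℝ ((∑ k ∈ Finset.Ico m n, randTerm X k) ω) w : ℝ) * Complex.I) ∂P := by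
    intro n
    rw [← charFun_map_sum_randTerm hmeas hindep hunif, charFun_apply,
      integral_map (measurable_sum_randTerm hmeas _).aemeasurable (by fun_prop)]
  simp_rw [heq]
  refine tendsto_integral_of_dominated_convergence (fun _ => 1) (fun n => ?_)
    (integrable_const 1) (fun n => ae_of_all _ fun ω => by rw [Complex.norm_exp_ofReal_mul_I]) ?_
  · have := measurable_sum_randTerm hmeas (Finset.Ico m n)
    fun_prop
  · filter_upwards [ae_tendsto_Ld hmeas hindep hunif] with ω hω
    have h1 : Tendsto (fun n => (∑ k ∈ Finset.Ico m n, randTerm X k) ω) atTop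
        (𝓝 (ldTail X m ω)) := by
      refine (hω.1.sub_const (∑ k ∈ Finset.range m, randTerm X k ω)).congr' ?_
      filter_upwards [eventually_ge_atTop m] with n hn
      rw [Finset.sum_apply, Finset.sum_Ico_eq_sub _ hn]
    have hcont : Continuous fun z : ℂ => Complex.exp ((inner ℝ z w : ℝ) * Complex.I) := by
      fun_prop
    exact (hcont.tendsto _).comp h1

/-- Both sides are limits of the same finite products, so independence of head and tail need not be
proved separately. -/
theorem charFun_map_Ld_eq_mul (hmeas : ∀ p, Measurable (X p)) (hindep : iIndepFun X P)
    (hunif : ∀ p, P.map (X p) = uniformCircle) (m : ℕ) (w : ℂ) :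
    charFun (P.map (Ld X)) w = charFun (P.map (∑ k ∈ Finset.range m, randTerm X k)) w *
      charFun (P.map (ldTail X m)) w := by
  have h0 : ldTail X 0 = Ld X := by
    funext ω
    simp [ldTail]
  have h1 := tendsto_prod_termCharFun hmeas hindep hunif 0 w
  have h2 := (tendsto_prod_termCharFun hmeas hindep hunif m w).const_mul
    (∏ k ∈ Finset.range m, termCharFun k w)
  rw [h0] at h1
  rw [charFun_map_sum_randTerm hmeas hindep hunif]
  refine tendsto_nhds_unique h1 (h2.congr' ?_)
  filter_upwards [eventually_ge_atTop m] with n hn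
  rw [Finset.range_eq_Ico, Finset.prod_Ico_consecutive _ (Nat.zero_le m) hn]

theorem norm_termCharFun_le_one (k : ℕ) (w : ℂ) : ‖termCharFun k w‖ ≤ 1 := by
  have : IsProbabilityMeasure (uniformCircle.map (primeTerm (nthPrime k))) :=
    Measure.isProbabilityMeasure_map (measurable_primeTerm _).aemeasurable
  exact norm_charFun_le_one w

theorem norm_charFun_map_ldTail_le_prod (hmeas : ∀ p, Measurable (X p)) (hindep : iIndepFun X P)
    (hunif : ∀ p, P.map (X p) = uniformCircle) (m : ℕ) (w : ℂ) {F : Finset ℕ}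
    (hF : ∀ k ∈ F, m ≤ k) :
    ‖charFun (P.map (ldTail X m)) w‖ ≤ ∏ k ∈ F, ‖termCharFun k w‖ := by
  refine le_of_tendsto (tendsto_prod_termCharFun hmeas hindep hunif m w).norm ?_
  filter_upwards [eventually_gt_atTop (F.sup id)] with n hn
  have hsub : F ⊆ Finset.Ico m n := fun k hk =>
    Finset.mem_Ico.2 ⟨hF k hk, (Finset.le_sup (f := id) hk).trans_lt hn⟩
  rw [norm_prod, ← Finset.prod_sdiff hsub]
  exact mul_le_of_le_one_left (Finset.prod_nonneg fun _ _ => norm_nonneg _)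
    (Finset.prod_le_one (fun _ _ => norm_nonneg _) fun _ _ => norm_termCharFun_le_one _ _)

/-- The characteristic functions of the tails decay like `exp (-c √‖w‖)`. -/
theorem exists_norm_charFun_map_ldTail_le (hmeas : ∀ p, Measurable (X p)) (hindep : iIndepFun X P)
    (hunif : ∀ p, P.map (X p) = uniformCircle) (m : ℕ) :
    ∃ C, ∀ w, ‖charFun (P.map (ldTail X m)) w‖ ≤ C * Real.exp (-(1 / 4096 * √‖w‖)) := by
  -- Primes beyond `nthPrime m` have index above `m`, so their factors occur in the tail.
  obtain ⟨W, hW⟩ := exists_primes_sum_sq_ge (nthPrime m)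
  have hinj : Function.Injective nthPrime := Nat.nth_injective Nat.infinite_setOfPred_prime
  have hprob : IsProbabilityMeasure (P.map (ldTail X m)) :=
    Measure.isProbabilityMeasure_map (aemeasurable_ldTail hmeas hindep hunif m)
  -- Chosen so that the trivial bound 1 suffices when ‖w‖ < W.
  refine ⟨Real.exp (1 / 4096 * √W), fun w => ?_⟩
  rw [← Real.exp_add]
  rcases lt_or_ge ‖w‖ W with hw | hw
  · refine (norm_charFun_le_one w).trans (Real.one_le_exp ?_)
    have := Real.sqrt_le_sqrt hw.le
    linarith
  · obtain ⟨F, hF, hsum⟩ := hW ‖w‖ hw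
    have hmem : ∀ k ∈ F.preimage nthPrime hinj.injOn, m ≤ k := by
      intro k hk
      refine (Nat.nth_lt_nth Nat.infinite_setOfPred_prime).1 (hF _ (Finset.mem_preimage.1 hk)).2.1
        |>.le
    refine (norm_charFun_map_ldTail_le_prod hmeas hindep hunif m w hmem).trans ?_
    have hle : ∀ k ∈ F.preimage nthPrime hinj.injOn, ‖termCharFun k w‖ ≤
        Real.exp (-((‖w‖ * (Real.log (nthPrime k) / (nthPrime k - 1))) ^ 2 / 32)) := by
      intro k hk
      obtain ⟨-, -, h3, h4⟩ := hF _ (Finset.mem_preimage.1 hk)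
      refine (norm_charFun_map_primeTerm_le h3 h4).trans ?_
      have := Real.add_one_le_exp
        (-((‖w‖ * (Real.log (nthPrime k) / (nthPrime k - 1))) ^ 2 / 32))
      linarith
    refine (Finset.prod_le_prod (fun _ _ => norm_nonneg _) hle).trans ?_
    rw [← Real.exp_sum, Finset.sum_preimage nthPrime F hinj.injOn
      (fun p => -((‖w‖ * (Real.log p / (p - 1))) ^ 2 / 32)), Finset.sum_neg_distrib]
    · refine Real.exp_le_exp.2 ?_
      have := Real.sqrt_nonneg W
      linarith
    · intro p hp hp'
      exact absurd ⟨primesEquiv.symm ⟨p, (hF p hp).1⟩, 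
        congrArg Subtype.val (primesEquiv.apply_symm_apply ⟨p, (hF p hp).1⟩)⟩ hp'

theorem integrable_pow_mul_charFun_map_ldTail (hmeas : ∀ p, Measurable (X p))
    (hindep : iIndepFun X P) (hunif : ∀ p, P.map (X p) = uniformCircle) (m n : ℕ) :
    Integrable fun s : ℂ => ‖s‖ ^ n * ‖charFun (P.map (ldTail X m)) ((2 * Real.pi) • s)‖ := by
  have hprob : IsProbabilityMeasure (P.map (ldTail X m)) :=
    Measure.isProbabilityMeasure_map (aemeasurable_ldTail hmeas hindep hunif m)
  obtain ⟨C, hC⟩ := exists_norm_charFun_map_ldTail_le hmeas hindep hunif m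
  refine integrable_pow_mul_of_le_exp_sqrt (continuous_charFun_two_pi_smul _)
    (c := 1 / 4096) (C := C) (by norm_num) (fun s => (hC _).trans ?_) n
  have hC0 : 0 ≤ C := by
    have := (norm_nonneg _).trans (hC 0)
    simpa using this
  refine mul_le_mul_of_nonneg_left (Real.exp_le_exp.2 ?_) hC0
  have : √‖s‖ ≤ √‖(2 * Real.pi) • s‖ := by
    refine Real.sqrt_le_sqrt ?_
    rw [norm_smul, Real.norm_of_nonneg (by positivity)]
    refine le_mul_of_one_le_left (norm_nonneg _) ?_
    linarith [Real.pi_gt_three]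
  linarith

theorem integrable_charFun_map_ldTail (hmeas : ∀ p, Measurable (X p))
    (hindep : iIndepFun X P) (hunif : ∀ p, P.map (X p) = uniformCircle) (m : ℕ) :
    Integrable fun s : ℂ => charFun (P.map (ldTail X m)) ((2 * Real.pi) • s) := by
  have hprob : IsProbabilityMeasure (P.map (ldTail X m)) :=
    Measure.isProbabilityMeasure_map (aemeasurable_ldTail hmeas hindep hunif m)
  have := integrable_pow_mul_charFun_map_ldTail hmeas hindep hunif m 0
  simp only [pow_zero, one_mul] at this
  exact (integrable_norm_iff (continuous_charFun_two_pi_smul _).aestronglyMeasurable).1 this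

/-- Otherwise almost surely all tails from `N₀` on have norm at least 1, although they tend to 0. -/
theorem exists_ldTail_ball_pos (hmeas : ∀ p, Measurable (X p)) (hindep : iIndepFun X P)
    (hunif : ∀ p, P.map (X p) = uniformCircle) (N₀ : ℕ) :
    ∃ N, N₀ ≤ N ∧ 0 < P.map (ldTail X N) (Metric.ball 0 1) := by
  by_contra! hc
  have hae : ∀ᵐ ω ∂P, ∀ N, N₀ ≤ N → 1 ≤ ‖ldTail X N ω‖ := by
    rw [ae_all_iff]
    intro N
    by_cases hN : N₀ ≤ N
    · have h := nonpos_iff_eq_zero.1 (hc N hN)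
      rw [Measure.map_apply_of_aemeasurable (aemeasurable_ldTail hmeas hindep hunif N)
        measurableSet_ball] at h
      filter_upwards [measure_eq_zero_iff_ae_notMem.1 h] with ω hω _
      simpa using hω
    · exact ae_of_all _ fun ω h => absurd h hN
  obtain ⟨ω, h1, h2⟩ := (hae.and (ae_tendsto_Ld hmeas hindep hunif)).exists
  have h3 : Tendsto (fun N => ‖ldTail X N ω‖) atTop (𝓝 0) := by
    simpa [ldTail] using (h2.1.const_sub (Ld X ω)).norm
  have h4 := ge_of_tendsto h3 (eventually_atTop.2 ⟨N₀, h1⟩)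
  norm_num at h4

end RandomEulerSum

/-! ### Densities of convolutions -/

section Convolution

open scoped FourierTransform InnerProductSpace

variable {E : Type*} [NormedAddCommGroup E] [InnerProductSpace ℝ E] [FiniteDimensional ℝ E]
  [MeasurableSpace E] [BorelSpace E] {μ ν κ : Measure E}

theorem norm_invDensity_le (μ : Measure E) (x : E) :
    ‖invDensity μ x‖ ≤ ∫ s : E, ‖charFun μ ((2 * Real.pi) • s)‖ :=
  VectorFourier.norm_fourierIntegral_le_integral_norm _ _ _ _ _

/-- The density of a convolution. -/
theorem invDensity_eq_integral_sub [IsProbabilityMeasure κ]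
    (hν : Integrable fun s : E => charFun ν ((2 * Real.pi) • s))
    (hmul : ∀ w, charFun μ w = charFun κ w * charFun ν w) (z : E) :
    invDensity μ z = ∫ s, invDensity ν (z - s) ∂κ := by
  have hL : Continuous fun p : E × E => (-innerₗ E) p.1 p.2 := by
    simp only [LinearMap.neg_apply, innerₗ_apply_apply]
    fun_prop
  have hf : Integrable fun t : E => 𝐞 (-⟪t, z⟫_ℝ) • charFun ν ((2 * Real.pi) • t) :=
    (Real.fourierIntegral_convergent_iff z).2 hν
  -- Fubini in dual form: the transform of `κ` is moved onto the integrable function `charFun ν`,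
  -- modulated by the point `z`.
  have hflip := VectorFourier.integral_fourierIntegral_smul_eq_flip (μ := (volume : Measure E))
    (ν := κ) (g := fun _ => (1 : ℂ)) Real.continuous_fourierChar hL hf (integrable_const _)
  calc invDensity μ z = ∫ t : E, (𝐞 (-⟪t, z⟫_ℝ) • charFun ν ((2 * Real.pi) • t)) •
        VectorFourier.fourierIntegral 𝐞 κ (-innerₗ E).flip (fun _ => (1 : ℂ)) t := by
        rw [invDensity, Real.fourier_eq]
        congr with t
        have hk : VectorFourier.fourierIntegral 𝐞 κ (-innerₗ E).flip (fun _ => (1 : ℂ)) t =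
            charFun κ ((2 * Real.pi) • t) := by
          rw [charFun_two_pi_smul_eq, VectorFourier.fourierIntegral]
          congr with s
          rw [LinearMap.flip_apply, LinearMap.neg_apply, LinearMap.neg_apply, neg_neg,
            innerₗ_apply_apply, real_inner_comm]
        rw [hk, hmul, smul_eq_mul, smul_mul_assoc, mul_comm (charFun κ _)]
    _ = _ := hflip.symm
    _ = _ := by
        congr with s
        rw [smul_eq_mul, mul_one, invDensity, Real.fourier_eq, VectorFourier.fourierIntegral]
        congr with t
        rw [smul_smul, ← AddChar.map_add_eq_mul, inner_sub_right]
        congr 2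
        change - -⟪t, s⟫_ℝ + -⟪t, z⟫_ℝ = -(⟪t, z⟫_ℝ - ⟪t, s⟫_ℝ)
        ring

/-- The density of a convolution is positive at `z` if `κ` charges the set of those `s` for which
the density of `ν` is positive at `z - s`. -/
theorem re_invDensity_pos_of_mul [IsProbabilityMeasure κ] [IsProbabilityMeasure ν]
    (hν : Integrable fun s : E => charFun ν ((2 * Real.pi) • s))
    (hmul : ∀ w, charFun μ w = charFun κ w * charFun ν w) (z : E)
    (hpos : 0 < κ {s | 0 < (invDensity ν (z - s)).re}) : 0 < (invDensity μ z).re := by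
  have hcont : Continuous fun s => invDensity ν (z - s) :=
    (continuous_invDensity hν).comp (by fun_prop)
  have hint : Integrable (fun s => invDensity ν (z - s)) κ :=
    Integrable.of_bound hcont.aestronglyMeasurable _ (ae_of_all _ fun s => norm_invDensity_le ν _)
  have hre : (invDensity μ z).re = ∫ s, (invDensity ν (z - s)).re ∂κ := by
    rw [invDensity_eq_integral_sub hν hmul]
    exact (integral_re (𝕜 := ℂ) hint).symm
  rw [hre, integral_pos_iff_support_of_nonneg (fun s => re_invDensity_nonneg hν _) hint.re]
  exact hpos.trans_le (measure_mono fun s hs => ne_of_gt hs)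

theorem exists_re_invDensity_pos [IsProbabilityMeasure ν]
    (hν : Integrable fun s : E => charFun ν ((2 * Real.pi) • s)) {B : Set E}
    (hB : MeasurableSet B) (hpos : 0 < ν B) : ∃ a ∈ B, 0 < (invDensity ν a).re := by
  by_contra! hc
  rw [eq_withDensity_invDensity hν, withDensity_apply _ hB,
    setLIntegral_congr_fun (g := fun _ => 0) hB fun a ha => ENNReal.ofReal_of_nonpos (hc a ha)]
    at hpos
  simp at hpos

end Convolution

/-! ### The density in real coordinates and its positivity -/

section Density

open scoped InnerProductSpace

theorem inner_re_add_im_mul_I (z : ℂ) (u v : ℝ) :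
    ⟪z, (u + v * Complex.I : ℂ)⟫_ℝ = u * z.re + v * z.im := by
  rw [Complex.inner]
  simp

/-- Integrals over `ℂ` as integrals over `ℝ × ℝ`. -/
theorem integral_complex_eq_integral_prod (f : ℂ → ℂ) :
    ∫ z, f z = ∫ w : ℝ × ℝ, f (w.1 + w.2 * Complex.I) := by
  rw [← Complex.volume_preserving_equiv_real_prod.symm.integral_comp']
  congr with w
  simp [Complex.measurableEquivRealProd_symm_apply, Complex.mk_eq_add_mul_I]

variable {Ω : Type*} [MeasurableSpace Ω] {P : Measure Ω} {X : Nat.Primes → Ω → ℂ}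

theorem Phi_eq_charFun (hLd : AEMeasurable (Ld X) P) (u v : ℝ) :
    Phi P X u v = charFun (P.map (Ld X)) (u + v * Complex.I) := by
  rw [charFun_apply, integral_map hLd (by fun_prop), Phi]
  congr with ω
  rw [inner_re_add_im_mul_I]
  push_cast
  ring_nf

/-- The substitution t = 2πs in real dimension 2 produces the factor (2π)⁻². -/
theorem invDensity_eq_integral_Phi (hLd : AEMeasurable (Ld X) P)
    (hint : Integrable fun w : ℝ × ℝ => Phi P X w.1 w.2) (x y : ℝ) :
    invDensity (P.map (Ld X)) (x + y * Complex.I) = 1 / (2 * (Real.pi : ℂ)) ^ 2 *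
      ∫ v : ℝ, ∫ u : ℝ, Complex.exp (-Complex.I * (u * x + v * y)) * Phi P X u v := by
  let G : ℂ → ℂ := fun t =>
    Complex.exp (-Complex.I * ((⟪t, (x + y * Complex.I : ℂ)⟫_ℝ : ℝ) : ℂ)) *
      charFun (P.map (Ld X)) t
  have hG : ∀ u v : ℝ, G (u + v * Complex.I) =
      Complex.exp (-Complex.I * (u * x + v * y)) * Phi P X u v := by
    intro u v
    simp only [G]
    rw [Phi_eq_charFun hLd, real_inner_comm, inner_re_add_im_mul_I]
    simp
  have h1 : invDensity (P.map (Ld X)) (x + y * Complex.I) = ∫ s : ℂ, G ((2 * Real.pi) • s) := by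
    rw [invDensity, Real.fourier_eq]
    congr with s
    simp only [G]
    rw [Circle.smul_def, Real.fourierChar_apply, smul_eq_mul, real_inner_smul_left]
    push_cast
    ring_nf
  rw [h1, Measure.integral_comp_smul, Complex.finrank_real_complex,
    integral_complex_eq_integral_prod]
  simp_rw [hG]
  rw [Measure.volume_eq_prod, integral_prod_symm]
  · rw [abs_of_nonneg (by positivity), Complex.real_smul]
    push_cast
    simp
  · refine hint.bdd_mul (c := 1) (by fun_prop) (ae_of_all _ fun w => ?_)
    rw [show -Complex.I * (w.1 * x + w.2 * y) = ((-(w.1 * x + w.2 * y) : ℝ) : ℂ) * Complex.I by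
      push_cast; ring, Complex.norm_exp_ofReal_mul_I]

variable [IsProbabilityMeasure P]

/-- The tail density is positive at some `a` in the unit ball. The head can take the value `z - a`,
which lies in the disc of radius ‖z‖ + 1, and it charges every neighbourhood of it. -/
theorem re_invDensity_map_Ld_pos (hmeas : ∀ p, Measurable (X p)) (hindep : iIndepFun X P)
    (hunif : ∀ p, P.map (X p) = uniformCircle) (z : ℂ) :
    0 < (invDensity (P.map (Ld X)) z).re := by
  obtain ⟨N₀, hN₀⟩ := exists_sum_primeTerm_eq (‖z‖ + 1)
  obtain ⟨N, hN, hball⟩ := exists_ldTail_ball_pos hmeas hindep hunif N₀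
  have hprob : IsProbabilityMeasure (P.map (ldTail X N)) :=
    Measure.isProbabilityMeasure_map (aemeasurable_ldTail hmeas hindep hunif N)
  have hprob' : IsProbabilityMeasure (P.map (∑ k ∈ Finset.range N, randTerm X k)) :=
    Measure.isProbabilityMeasure_map (measurable_sum_randTerm hmeas _).aemeasurable
  have hint := integrable_charFun_map_ldTail hmeas hindep hunif N
  obtain ⟨a, ha, hpos⟩ := exists_re_invDensity_pos hint measurableSet_ball hball
  have hza : ‖z - a‖ ≤ ‖z‖ + 1 :=
    (norm_sub_le z a).trans (by linarith [mem_ball_zero_iff.1 ha])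
  obtain ⟨x, hx, hsum⟩ := hN₀ N hN (z - a) hza
  refine re_invDensity_pos_of_mul hint (charFun_map_Ld_eq_mul hmeas hindep hunif N) z
    (map_sum_randTerm_pos hmeas hindep hunif ?_ hx ?_)
  · exact isOpen_lt continuous_const (Complex.continuous_re.comp
      ((continuous_invDensity hint).comp (by fun_prop)))
  · rw [hsum]
    simpa using hpos

end Density

end RandomLogDeriv

/-! ### The main theorem -/

open RandomLogDeriv in
theorem corollary2p3 {Ω : Type*} [MeasurableSpace Ω] (P : Measure Ω) [IsProbabilityMeasure P]
    (X : Nat.Primes → Ω → ℂ) (hmeas : ∀ p, Measurable (X p))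
    (hindep : iIndepFun X P) (hunif : ∀ p, P.map (X p) = uniformCircle) :
    -- the random series converges almost surely, to `Ld(1, X)`, and it can be summed over primes
    (∀ᵐ ω ∂P, Tendsto (ldPartial (fun p => X p ω)) atTop (𝓝 (Ld X ω)) ∧
      Tendsto (primePartial (fun p => X p ω)) atTop (𝓝 (-Ld X ω))) ∧
    -- the Fourier inversion integral converges absolutely
    Integrable (fun w : ℝ × ℝ => Phi P X w.1 w.2) ∧
    ∃ g : ℝ → ℝ → ℝ,
      -- `g` is given by Fourier inversion
      (∀ x y : ℝ, (g x y : ℂ) = 1 / (2 * (Real.pi : ℂ)) ^ 2 *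
        ∫ v : ℝ, ∫ u : ℝ, Complex.exp (-Complex.I * (u * x + v * y)) * Phi P X u v) ∧
      -- `g` is smooth
      ContDiff ℝ (⊤ : ℕ∞) (fun z : ℝ × ℝ => g z.1 z.2) ∧
      -- `g` is the density of the joint distribution of the real and imaginary parts
      P.map (fun ω => ((Ld X ω).re, (Ld X ω).im)) =
        (volume : Measure (ℝ × ℝ)).withDensity (fun z => ENNReal.ofReal (g z.1 z.2)) ∧
      -- `g` is positive everywhere
      ∀ x y : ℝ, 0 < g x y := by
  have hLd := aemeasurable_Ld hmeas hindep hunif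
  have hprob : IsProbabilityMeasure (P.map (Ld X)) := Measure.isProbabilityMeasure_map hLd
  have htail : ldTail X 0 = Ld X := by
    funext ω
    simp [ldTail]
  -- The tail with no prime removed is the whole sum, so the tail estimates apply to `Ld` itself.
  have hmom := integrable_pow_mul_charFun_map_ldTail hmeas hindep hunif 0
  have hint := integrable_charFun_map_ldTail hmeas hindep hunif 0
  rw [htail] at hmom hint
  have hcont := continuous_invDensity hint
  have hPhi : Integrable (fun w : ℝ × ℝ => Phi P X w.1 w.2) := by
    have h1 : Integrable (charFun (P.map (Ld X))) :=
      (integrable_comp_smul_iff volume _ (by positivity : (2 * Real.pi) ≠ 0)).1 hint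
    rw [← Complex.volume_preserving_equiv_real_prod.symm.integrable_comp_emb
      (MeasurableEquiv.measurableEmbedding _)] at h1
    refine h1.congr (ae_of_all _ fun w => ?_)
    simp [Phi_eq_charFun hLd, Complex.measurableEquivRealProd_symm_apply, Complex.mk_eq_add_mul_I]
  refine ⟨(ae_tendsto_Ld hmeas hindep hunif).mono fun _ h => h.2, hPhi,
    fun x y => (invDensity (P.map (Ld X)) (x + y * Complex.I)).re, fun x y => ?_, ?_, ?_,
    fun x y => re_invDensity_map_Ld_pos hmeas hindep hunif _⟩
  · rw [ofReal_re_invDensity]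
    exact invDensity_eq_integral_Phi hLd hPhi x y
  · have h1 : ContDiff ℝ (⊤ : ℕ∞) (invDensity (P.map (Ld X))) :=
      Real.contDiff_fourier fun n _ => hmom n
    refine Complex.reCLM.contDiff.comp (h1.comp ?_)
    exact (Complex.ofRealCLM.contDiff.comp contDiff_fst).add
      ((Complex.ofRealCLM.contDiff.comp contDiff_snd).mul contDiff_const)
  · have h1 : P.map (fun ω => ((Ld X ω).re, (Ld X ω).im)) =
        (P.map (Ld X)).map Complex.measurableEquivRealProd :=
      (AEMeasurable.map_map_of_aemeasurable
        Complex.measurableEquivRealProd.measurable.aemeasurable hLd).symm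
    rw [h1]
    nth_rewrite 1 [eq_withDensity_invDensity hint]
    ext s hs
    rw [Measure.map_apply Complex.measurableEquivRealProd.measurable hs, withDensity_apply _ hs,
      withDensity_apply _ (Complex.measurableEquivRealProd.measurable hs),
      ← Complex.volume_preserving_equiv_real_prod.setLIntegral_comp_preimage_emb
        (MeasurableEquiv.measurableEmbedding _)]
    simp [Complex.measurableEquivRealProd_apply, Complex.re_add_im]
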